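/- Let $X$ be a geodesic Gromov-hyperbolic metric space whose visual boundary $\partial X$ (Cauchy--Gromov sequences modulo the relation $(y_n|z_n)\to\infty$, with its usual topology) has more than two points. Let $M$ be an amenable (Hausdorff) locally compact group with a continuous isometric action on $X$ that is metrically proper (for every $x\in X$ the function $g\mapsto d(x,gx)$ is proper) and cobounded. Then: (i) The action is focal, i.e. some element of $M$ acts as a hyperbolic isometry, any two hyperbolic elements have a common endpoint in $\partial X$, and not all hyperbolic elements have the same pair of endpoints. Moreover $M$ has a unique fixed point $\xi$ in $\partial X$. (ii) Call horokernel based at $\xi$ any accumulation point $h$, for pointwise convergence, of a sequence of functions $(x,y)\mapsto d(x,x_n)-d(y,x_n)$ with $x_n\to\xi$. The Busemann quasicharacter $\beta_\xi(g)=\lim_{n\to\infty}\frac1n h(x,g^nx)$ is well defined on $M$ (the limit exists and does not depend on $x\in X$ nor on the horokernel $h$ based at $\xi$); it is a continuous homomorphism $M\to\mathbf R$, and $\beta_\xi(M)$ is a closed nonzero subgroup of $\mathbf R$. In particular, writing $U=\ker\beta_\xi$, for every $\alpha\in M\setminus U$ the subgroup $\langle U\cup\{\alpha\}\rangle$ is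 closed, cocompact and normal in $M$, and $(u,a)\mapsto ua$ is an isomorphism of topological groups from the semidirect product $U\rtimes\langle\alpha\rangle$ (with $\alpha$ acting by conjugation) onto it. (iii) The action of $U$ on $\partial X\setminus\{\xi\}$ is transitive, and it is proper: for every closed subset $K$ of $\partial X$ not containing $\xi$, the set $\{u\in U: uK\cap K\neq\varnothing\}$ is relatively compact in $U$ (equivalently, bounded for the pseudo-distances $d_x(g,h)=d(gx,hx)$). (iv) Every $\alpha\in M$ with $\beta_\xi(\alpha)<0$ acts by conjugation as a compacting automorphism of $U$: there is a compact subset $V\subseteq U$ such that for every $u\in U$ one has $\alpha^n u\alpha^{-n}\in V$ for all sufficiently large $n$. -/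

import Mathlib

open Filter Topology

namespace Hyp

noncomputable section

section Spaces

variable (X : Type*) [MetricSpace X]

/-- Any two points are joined by a geodesic segment. -/
def IsGeodesic : Prop :=
  ∀ x y : X, ∃ γ : ℝ → X, γ 0 = x ∧ γ (dist x y) = y ∧
    ∀ s ∈ Set.Icc 0 (dist x y), ∀ t ∈ Set.Icc 0 (dist x y), dist (γ s) (γ t) = |s - t|

variable {X}

/-- The Gromov product `(y|z)_o`. -/
def gromovProduct (o y z : X) : ℝ := (dist o y + dist o z - dist y z) / 2

variable (X) in
/-- `X` is `δ`-hyperbolic for some `δ` (four-point condition). -/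
class IsGromovHyperbolic : Prop where
  exists_delta : ∃ δ : ℝ, ∀ o y z w : X,
    min (gromovProduct o y w) (gromovProduct o w z) - δ ≤ gromovProduct o y z

/-- Cauchy-Gromov sequences: `(x_n|x_m) → ∞` when `n` and `m` both tend to infinity. -/
def IsCauchyGromov (x : ℕ → X) : Prop :=
  ∀ o : X, Tendsto (fun p : ℕ × ℕ => gromovProduct o (x p.1) (x p.2)) atTop atTop

/-- Two sequences are asymptotic if `(y_n|z_n) → ∞`. -/
def Asymptotic (y z : ℕ → X) : Prop :=
  ∀ o : X, Tendsto (fun n => gromovProduct o (y n) (z n)) atTop atTop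

theorem gromovProduct_comm (o y z : X) : gromovProduct o y z = gromovProduct o z y := by
  unfold gromovProduct
  rw [dist_comm y z]
  ring

theorem IsCauchyGromov.refl {x : ℕ → X} (h : IsCauchyGromov x) : Asymptotic x x := by
  intro o
  have h2 : Tendsto (fun n : ℕ => (n, n)) atTop (atTop : Filter (ℕ × ℕ)) := by
    rw [← prod_atTop_atTop_eq]
    exact tendsto_id.prodMk tendsto_id
  exact (h o).comp h2

theorem Asymptotic.symm {y z : ℕ → X} (h : Asymptotic y z) : Asymptotic z y := by
  intro o
  simpa only [gromovProduct_comm o (y _) (z _)] using h o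

theorem Asymptotic.trans [IsGromovHyperbolic X] {y w z : ℕ → X}
    (h₁ : Asymptotic y w) (h₂ : Asymptotic w z) : Asymptotic y z := by
  obtain ⟨δ, hδ⟩ := IsGromovHyperbolic.exists_delta (X := X)
  intro o
  rw [tendsto_atTop]
  intro b
  filter_upwards [(tendsto_atTop.1 (h₁ o)) (b + δ), (tendsto_atTop.1 (h₂ o)) (b + δ)]
    with n hn₁ hn₂
  have h3 := hδ o (y n) (z n) (w n)
  have h4 := le_min hn₁ hn₂
  linarith

/-- Cauchy-Gromov sequences up to the asymptotic relation. -/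
def cauchyGromovSetoid (X : Type*) [MetricSpace X] [IsGromovHyperbolic X] :
    Setoid {x : ℕ → X // IsCauchyGromov x} where
  r y z := Asymptotic y.1 z.1
  iseqv := ⟨fun x => x.2.refl, fun h => h.symm, fun h k => h.trans k⟩

/-- The visual (Gromov) boundary of `X`. -/
def Boundary (X : Type*) [MetricSpace X] [IsGromovHyperbolic X] : Type _ :=
  Quotient (cauchyGromovSetoid X)

variable [IsGromovHyperbolic X]

/-- The sequence `x` is Cauchy-Gromov and represents (that is, converges to) `ξ`. -/
def Represents (x : ℕ → X) (ξ : Boundary X) : Prop :=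
  ∃ h : IsCauchyGromov x, Quotient.mk (cauchyGromovSetoid X) ⟨x, h⟩ = ξ

/-- The boundary points represented by some `(y_i)` with `liminf (y_i|x_i)_o ≥ r`. -/
def basicNhd (o : X) (x : ℕ → X) (r : ℝ) : Set (Boundary X) :=
  {ζ | ∃ y : ℕ → X, Represents y ζ ∧
    ∀ c < r, ∀ᶠ i in atTop, c ≤ gromovProduct o (y i) (x i)}

theorem basicNhd_anti (o : X) (x : ℕ → X) {r s : ℝ} (h : r ≤ s) :
    basicNhd o x s ⊆ basicNhd o x r := by
  rintro ζ ⟨y, hy, hc⟩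
  exact ⟨y, hy, fun c hcr => hc c (hcr.trans_le h)⟩

/-- The topology on the boundary in which the sets `basicNhd o x n` are the basic
neighbourhoods of the point represented by `x`. -/
instance : TopologicalSpace (Boundary X) where
  IsOpen O := ∀ ξ ∈ O, ∀ (x : ℕ → X) (o : X), Represents x ξ → ∃ r : ℝ, basicNhd o x r ⊆ O
  isOpen_univ := fun _ _ _ _ _ => ⟨0, Set.subset_univ _⟩
  isOpen_inter := by
    intro s t hs ht ξ hξ x o hx
    obtain ⟨r₁, h₁⟩ := hs ξ hξ.1 x o hx
    obtain ⟨r₂, h₂⟩ := ht ξ hξ.2 x o hx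
    exact ⟨max r₁ r₂, Set.subset_inter
      ((basicNhd_anti o x (le_max_left _ _)).trans h₁)
      ((basicNhd_anti o x (le_max_right _ _)).trans h₂)⟩
  isOpen_sUnion := by
    intro S hS ξ hξ x o hx
    obtain ⟨t, htS, hξt⟩ := hξ
    obtain ⟨r, hr⟩ := hS t htS ξ hξt x o hx
    exact ⟨r, hr.trans (Set.subset_sUnion_of_mem htS)⟩

variable (X) in
/-- The boundary has more than two points. -/
def IsNonElementary : Prop := ∃ a b c : Boundary X, a ≠ b ∧ a ≠ c ∧ b ≠ c

/-- Horokernels based at `ξ`: accumulation points, for pointwise convergence, of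
`(x, y) ↦ d(x, x_n) - d(y, x_n)` where `(x_n)` represents `ξ`. -/
def IsHorokernel (ξ : Boundary X) (h : X × X → ℝ) : Prop :=
  ∃ x : ℕ → X, Represents x ξ ∧
    MapClusterPt h atTop (fun (n : ℕ) (p : X × X) => dist p.1 (x n) - dist p.2 (x n))

end Spaces

section Actions

variable {G : Type*} [Group G] {X : Type*} [MetricSpace X] [MulAction G X] [IsIsometricSMul G X]

theorem gromovProduct_smul (g : G) (o y z : X) :
    gromovProduct o (g • y) (g • z) = gromovProduct (g⁻¹ • o) y z := by
  have h : ∀ w : X, dist o (g • w) = dist (g⁻¹ • o) w := fun w => by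
    rw [← dist_smul g (g⁻¹ • o) w, smul_inv_smul]
  unfold gromovProduct
  rw [h, h, dist_smul]

theorem IsCauchyGromov.smul (g : G) {x : ℕ → X} (h : IsCauchyGromov x) :
    IsCauchyGromov (fun n => g • x n) := by
  intro o
  simpa only [gromovProduct_smul] using h (g⁻¹ • o)

variable [IsGromovHyperbolic X]

/-- The induced action on the boundary: `g • [x_n] = [g • x_n]`. -/
instance : MulAction G (Boundary X) where
  smul g := Quotient.map (sa := cauchyGromovSetoid X) (sb := cauchyGromovSetoid X)
    (fun x => ⟨fun n => g • x.1 n, x.2.smul g⟩) (by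
      intro y z h o
      simpa only [gromovProduct_smul] using h (g⁻¹ • o))
  one_smul := by
    rintro ⟨x, hx⟩
    refine congrArg (Quotient.mk (cauchyGromovSetoid X)) (Subtype.ext ?_)
    funext n
    exact one_smul G (x n)
  mul_smul := by
    rintro g k ⟨x, hx⟩
    refine congrArg (Quotient.mk (cauchyGromovSetoid X)) (Subtype.ext ?_)
    funext n
    exact mul_smul g k (x n)

/-- The limit set of a subgroup `H`: boundary points represented by a sequence `(g_n • x)`
with `g_n ∈ H`. -/
def limitSet (X : Type*) [MetricSpace X] [MulAction G X] [IsGromovHyperbolic X]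
    (H : Subgroup G) : Set (Boundary X) :=
  {ξ | ∃ (g : ℕ → G) (x : X), (∀ n, g n ∈ H) ∧ Represents (fun n => g n • x) ξ}

/-- `g` acts as a hyperbolic isometry: `lim d(x, g^n x) / n > 0`. -/
def IsHyperbolicElement (X : Type*) [MetricSpace X] [MulAction G X] (g : G) : Prop :=
  ∃ (x : X) (l : ℝ), 0 < l ∧ Tendsto (fun n : ℕ => dist x (g ^ n • x) / n) atTop (𝓝 l)

/-- The endpoints of `g`: the limit set of the cyclic group that it generates. -/
def endpoints (X : Type*) [MetricSpace X] [MulAction G X] [IsGromovHyperbolic X]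
    (g : G) : Set (Boundary X) :=
  limitSet X (Subgroup.zpowers g)

variable (G X) in
/-- Lineal action: there is a hyperbolic element, and any two have the same endpoints. -/
def IsLineal : Prop :=
  (∃ g : G, IsHyperbolicElement X g) ∧
    ∀ g k : G, IsHyperbolicElement X g → IsHyperbolicElement X k → endpoints X g = endpoints X k

variable (G X) in
/-- Focal action: there is a hyperbolic element, the action is not lineal, and any two
hyperbolic elements have a common endpoint. -/
def IsFocal : Prop :=
  (∃ g : G, IsHyperbolicElement X g) ∧ ¬ IsLineal G X ∧
    ∀ g k : G, IsHyperbolicElement X g → IsHyperbolicElement X k →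
      (endpoints X g ∩ endpoints X k).Nonempty

/-- `β` is the Busemann quasicharacter at `ξ`: for every horokernel `h` based at `ξ`, every
point `x` and every `g` fixing `ξ`, the limit of `h(x, g^n x) / n` exists and is `β g`
(and there are horokernels, so that `β` is determined on the stabilizer of `ξ`). -/
def IsBusemannQuasicharacter (ξ : Boundary X) (β : G → ℝ) : Prop :=
  (∃ h : X × X → ℝ, IsHorokernel ξ h) ∧
    ∀ h : X × X → ℝ, IsHorokernel ξ h → ∀ (x : X) (g : G), g • ξ = ξ →
      Tendsto (fun n : ℕ => h (x, g ^ n • x) / n) atTop (𝓝 (β g))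

variable (G X) in
/-- Cobounded action: `X` is covered by the translates of a ball. -/
def IsCobounded : Prop := ∃ (x : X) (r : ℝ), ∀ y : X, ∃ g : G, dist y (g • x) ≤ r

variable (G X) in
/-- Metrically proper action: each function `g ↦ d(x, g x)` is proper. -/
def IsMetricallyProper [TopologicalSpace G] : Prop :=
  ∀ x : X, IsProperMap (fun g : G => dist x (g • x))

/-- The subgroup `U` acts properly on the complement of `ξ` in the boundary: for every closed
set `K` of boundary points not containing `ξ`, the set of all `u` in `U` such that `uK` meets `K`
is bounded for each pseudo-distance `(g, h) ↦ d(g x, h x)`, and relatively compact in `U`. -/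
def ActsProperlyOff [TopologicalSpace G] (U : Subgroup G) (ξ : Boundary X) : Prop :=
  ∀ K : Set (Boundary X), IsClosed K → ξ ∉ K →
    (∀ x : X, ∃ R : ℝ, ∀ u : U, (∃ η ∈ K, (u : G) • η ∈ K) → dist x ((u : G) • x) ≤ R) ∧
    IsCompact (closure {u : U | ∃ η ∈ K, (u : G) • η ∈ K})

end Actions

section Groups

open BoundedContinuousFunction

/-- Amenability: there is a left-invariant mean on the bounded continuous functions. -/
def IsAmenable (G : Type*) [Group G] [TopologicalSpace G] [IsTopologicalGroup G] : Prop :=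
  ∃ m : (G →ᵇ ℝ) →ₗ[ℝ] ℝ, m (BoundedContinuousFunction.const G 1) = 1 ∧
    (∀ f : G →ᵇ ℝ, 0 ≤ f → 0 ≤ m f) ∧
    ∀ (g : G) (f : G →ᵇ ℝ),
      m (f.compContinuous ⟨fun h => g⁻¹ * h, continuous_const_mul g⁻¹⟩) = m f

/-- Compacting automorphisms of a topological group. -/
def IsCompacting {H : Type*} [Group H] [TopologicalSpace H] (a : MulAut H) : Prop :=
  Continuous a ∧ Continuous a.symm ∧
    ∃ V : Set H, IsCompact V ∧ ∀ g : H, ∃ n₀ : ℕ, ∀ n > n₀, (a ^ n) g ∈ V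

/-- The conjugation action of the cyclic group generated by `α` on a normal subgroup. -/
def conjCyclic {G : Type*} [Group G] (U : Subgroup G) [U.Normal] (α : G) :
    Subgroup.zpowers α →* MulAut U :=
  (MulAut.conjNormal (H := U)).comp (Subgroup.zpowers α).subtype

end Groups

end

end Hyp

/-! Amenability enters only through averaging. Differences `f (g • y) - f (g • z)` of a 1-Lipschitz
function are bounded in `g`, so an invariant mean turns `f` into a function that each group element
shifts by a constant; these constants form a character (`IsAmenable.exists_average`).

Averaging the distance to a point gives `F` with character `κ`. If `κ = 0`, coboundedness makes `F`
bounded, while long tripods force it to be large. So some `g` drives `F` to minus infinity along its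
orbit. As `F` is nearly convex, any two very low points have a large Gromov product: the orbit
converges, and every group element fixes its limit `ξ` (`IsAmenable.exists_fixed`).

Averaging a horokernel at `ξ` gives a horofunction `B` that is exactly equivariant up to a
character, again called `κ`; the Busemann quasicharacter is `-κ`. The rest follows from the
four-point inequality with `ξ` as one of the points: descending rays towards `ξ` from a common start
stay together (`dist_le_of_rays`). Hence, if `κ α < 0`, each `g` displaces `α ^ n • o` by at most
`|κ g| + E` for large `n` (`exists_eventually_dist_le`). This yields the compacting property, closed
range, cocompactness and nonvanishing of `κ` on hyperbolic elements. Following rays backwards and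
extracting limits by properness yields transitivity of the kernel off `ξ`, and from it focality and
uniqueness of the fixed point. -/

namespace Hyp

/-! ### Gromov products and the four-point inequality -/

section Geometry

variable {X : Type*} [MetricSpace X]

/-- `δ` is a hyperbolicity constant for `X`. -/
def IsHypConst (X : Type*) [MetricSpace X] (δ : ℝ) : Prop :=
  ∀ o y z w : X, min (gromovProduct o y w) (gromovProduct o w z) - δ ≤ gromovProduct o y z

theorem IsHypConst.nonneg {δ : ℝ} (hδ : IsHypConst X δ) (o : X) : 0 ≤ δ := by
  have := hδ o o o o
  simp [gromovProduct] at this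
  linarith

theorem IsHypConst.four_point {δ : ℝ} (hδ : IsHypConst X δ) (y z w o : X) :
    dist y z + dist w o ≤ max (dist y w + dist z o) (dist z w + dist y o) + 2 * δ := by
  have h := hδ o y z w
  unfold gromovProduct at h
  rw [dist_comm w o, dist_comm z o, dist_comm y o, dist_comm z w]
  rcases min_cases ((dist o y + dist o w - dist y w) / 2) ((dist o w + dist o z - dist w z) / 2)
    with ⟨h1, _⟩ | ⟨h1, _⟩
  · have := le_max_left (dist y w + dist o z) (dist w z + dist o y)
    linarith
  · have := le_max_right (dist y w + dist o z) (dist w z + dist o y)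
    linarith

theorem IsHypConst.min_le {δ : ℝ} (hδ : IsHypConst X δ) (o y z w : X) {r : ℝ}
    (h₁ : r ≤ gromovProduct o y w) (h₂ : r ≤ gromovProduct o w z) :
    r - δ ≤ gromovProduct o y z := by
  have := hδ o y z w
  have := le_min h₁ h₂
  linarith

theorem gromovProduct_le_left (o y z : X) : gromovProduct o y z ≤ dist o y := by
  unfold gromovProduct
  linarith [dist_triangle o y z]

theorem gromovProduct_self (o y : X) : gromovProduct o y y = dist o y := by
  simp [gromovProduct]

theorem gromovProduct_base (o p y z : X) :
    gromovProduct o y z - dist o p ≤ gromovProduct p y z := by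
  unfold gromovProduct
  linarith [dist_triangle o p y, dist_triangle o p z]

theorem gromovProduct_near (o y z w : X) :
    gromovProduct o y z - dist z w ≤ gromovProduct o y w := by
  unfold gromovProduct
  linarith [dist_triangle o w z, dist_triangle y z w, dist_comm z w]

/-- Along a geodesic from `o` the Gromov product based at `o` is monotone. -/
theorem gromovProduct_mono_geodesic {o a a' : X} (h : dist o a' + dist a' a = dist o a) (z : X) :
    gromovProduct o a' z ≤ gromovProduct o a z := by
  unfold gromovProduct
  linarith [dist_triangle a a' z, dist_comm a a']

theorem IsGeodesic.exists_between (hgeod : IsGeodesic X) (o a : X) {R : ℝ} (h0 : 0 ≤ R)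
    (hR : R ≤ dist o a) : ∃ a' : X, dist o a' = R ∧ dist o a' + dist a' a = dist o a := by
  obtain ⟨γ, g0, g1, hγ⟩ := hgeod o a
  have hd : (0 : ℝ) ≤ dist o a := dist_nonneg
  have h1 := hγ 0 ⟨le_rfl, hd⟩ R ⟨h0, hR⟩
  have h2 := hγ R ⟨h0, hR⟩ (dist o a) ⟨hd, le_rfl⟩
  rw [g0, zero_sub, abs_neg, abs_of_nonneg h0] at h1
  rw [g1, abs_sub_comm, abs_of_nonneg (by linarith)] at h2
  exact ⟨γ R, h1, by rw [h1, h2]; ring⟩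

theorem isCauchyGromov_iff {x : ℕ → X} (o : X) :
    IsCauchyGromov x ↔ ∀ R : ℝ, ∃ N, ∀ n ≥ N, ∀ m ≥ N, R ≤ gromovProduct o (x n) (x m) := by
  constructor
  · intro h R
    obtain ⟨⟨a, b⟩, hab⟩ := eventually_atTop.1 (tendsto_atTop.1 (h o) R)
    exact ⟨max a b, fun n hn m hm => hab (n, m)
      ⟨(le_max_left _ _).trans hn, (le_max_right _ _).trans hm⟩⟩
  · intro h p
    rw [tendsto_atTop]
    intro R
    obtain ⟨N, hN⟩ := h (R + dist o p)
    refine eventually_atTop.2 ⟨(N, N), fun q hq => ?_⟩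
    have := hN q.1 hq.1 q.2 hq.2
    have := gromovProduct_base o p (x q.1) (x q.2)
    linarith

theorem asymptotic_iff {y z : ℕ → X} (o : X) :
    Asymptotic y z ↔ Tendsto (fun n => gromovProduct o (y n) (z n)) atTop atTop := by
  refine ⟨fun h => h o, fun h p => ?_⟩
  rw [tendsto_atTop] at h ⊢
  intro R
  filter_upwards [h (R + dist o p)] with n hn
  have := gromovProduct_base o p (y n) (z n)
  linarith

theorem IsCauchyGromov.tendsto_dist {x : ℕ → X} (h : IsCauchyGromov x) (o : X) :
    Tendsto (fun n => dist o (x n)) atTop atTop := by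
  simpa only [gromovProduct_self] using h.refl o

/-- A sequence asymptotic to a Cauchy-Gromov sequence is Cauchy-Gromov. -/
theorem IsCauchyGromov.of_asymptotic [IsGromovHyperbolic X] {x y : ℕ → X}
    (h : IsCauchyGromov x) (hxy : Asymptotic y x) : IsCauchyGromov y := by
  obtain ⟨δ, hδ⟩ := IsGromovHyperbolic.exists_delta (X := X)
  intro o
  revert o
  by_contra! hc
  obtain ⟨o, hc⟩ := hc
  refine hc ((isCauchyGromov_iff o).2 (fun R => ?_) o)
  obtain ⟨N, hN⟩ := (isCauchyGromov_iff o).1 h (R + 2 * |δ|)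
  obtain ⟨N', hN'⟩ := eventually_atTop.1 (tendsto_atTop.1 (hxy o) (R + 2 * |δ|))
  refine ⟨max N N', fun n hn m hm => ?_⟩
  have h1 := hN' n ((le_max_right _ _).trans hn)
  have h2 := hN' m ((le_max_right _ _).trans hm)
  have h3 := hN n ((le_max_left _ _).trans hn) m ((le_max_left _ _).trans hm)
  have hδ' : IsHypConst X δ := hδ
  have h4 := hδ'.min_le o (y n) (x m) (x n) h1 h3
  have := le_abs_self δ
  have := abs_nonneg δ
  rw [gromovProduct_comm] at h2
  have h5 := hδ'.min_le o (y n) (y m) (x m) (r := R + |δ|) (by linarith) (by linarith)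
  linarith

/-- Two Cauchy-Gromov sequences whose products are infrequently large have bounded products. -/
theorem IsHypConst.le_of_frequently {δ : ℝ} (hδ : IsHypConst X δ) {y z : ℕ → X}
    (hy : IsCauchyGromov y) (hz : IsCauchyGromov z) (o : X) {r : ℝ}
    (h : ∃ᶠ i in atTop, gromovProduct o (y i) (z i) < r) :
    ∃ N, ∀ n ≥ N, ∀ m ≥ N, gromovProduct o (y n) (z m) ≤ r + 2 * δ := by
  have h0 := hδ.nonneg o
  obtain ⟨N, hN⟩ := (isCauchyGromov_iff o).1 hy (r + 2 * δ)
  obtain ⟨N', hN'⟩ := (isCauchyGromov_iff o).1 hz (r + 2 * δ)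
  obtain ⟨i, hi, hir⟩ := frequently_atTop.1 h (max N N')
  have hi1 := (le_max_left _ _).trans hi
  have hi2 := (le_max_right _ _).trans hi
  refine ⟨max N N', fun n hn m hm => ?_⟩
  by_contra! hc
  have h1 := hδ.min_le o (y i) (z m) (y n) (hN i hi1 n ((le_max_left _ _).trans hn)) hc.le
  have h2 := hN' m ((le_max_right _ _).trans hm) i hi2
  have h3 := hδ.min_le o (y i) (z i) (z m) (r := r + δ) (by linarith) (by linarith)
  linarith

theorem IsCauchyGromov.asymptotic_of_dist_le {x y : ℕ → X} (hx : IsCauchyGromov x) {r : ℝ}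
    (h : ∀ n, dist (x n) (y n) ≤ r) : Asymptotic y x := by
  refine Asymptotic.symm fun o => ?_
  rw [tendsto_atTop]
  intro R
  filter_upwards [tendsto_atTop.1 (hx.refl o) (R + r)] with n hn
  have := gromovProduct_near o (x n) (x n) (y n)
  linarith [h n]

/-- Cobounded actions, seen from an arbitrary base point. -/
theorem IsCobounded.exists_radius {G : Type*} [Group G] [MulAction G X] [IsIsometricSMul G X]
    (h : IsCobounded G X) (o : X) :
    ∃ r : ℝ, ∀ y : X, ∃ g : G, dist y (g • o) ≤ r := by
  obtain ⟨x, r, hr⟩ := h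
  refine ⟨r + dist x o, fun y => ?_⟩
  obtain ⟨g, hg⟩ := hr y
  refine ⟨g, (dist_triangle _ (g • x) _).trans ?_⟩
  rw [dist_smul]
  linarith

/-- The hypothesis makes `d(p,q) + d(x,x')` at most `d(p,x') + d(q,x)`, so the four-point inequality
compares the two other pairings directly. This is why a horokernel depends on its base point only,
up to `2δ`. -/
theorem IsHypConst.dist_sub_le {δ : ℝ} (hδ : IsHypConst X δ) {p q x x' : X}
    (h : dist p q ≤ gromovProduct p x x') :
    dist p x - dist q x ≤ dist p x' - dist q x' + 2 * δ := by
  have h1 := hδ.four_point p x' q x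
  have h2 : dist p q + dist x' x ≤ dist p x' + dist q x := by
    have := dist_triangle p q x
    unfold gromovProduct at h
    rw [dist_comm x' x]
    linarith
  have h3 := hδ.four_point p x x' q
  have h4 : dist x x' + dist p q ≤ dist p x' + dist q x := by rwa [dist_comm x x', add_comm]
  have h5 : max (dist p x' + dist x q) (dist x x' + dist p q) ≤ dist p x' + dist q x :=
    max_le (by rw [dist_comm x q]) h4
  rw [dist_comm x' q] at h3
  linarith

end Geometry

/-! ### Boundary points and the sequences representing them -/

section BoundaryPoints

variable {X : Type*} [MetricSpace X] [IsGromovHyperbolic X]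

theorem exists_hypConst (X : Type*) [MetricSpace X] [IsGromovHyperbolic X] :
    ∃ δ, IsHypConst X δ := IsGromovHyperbolic.exists_delta

theorem Boundary.exists_represents (ξ : Boundary X) : ∃ x : ℕ → X, Represents x ξ := by
  obtain ⟨⟨x, hx⟩, h⟩ := Quotient.exists_rep ξ
  exact ⟨x, hx, h⟩

theorem Represents.cauchy {x : ℕ → X} {ξ : Boundary X} (h : Represents x ξ) :
    IsCauchyGromov x := h.1

theorem represents_mk {x : ℕ → X} (h : IsCauchyGromov x) :
    Represents x (Quotient.mk (cauchyGromovSetoid X) ⟨x, h⟩ : Boundary X) := ⟨h, rfl⟩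

theorem Represents.asymptotic {x y : ℕ → X} {ξ : Boundary X} (hx : Represents x ξ)
    (hy : Represents y ξ) : Asymptotic x y := by
  obtain ⟨h1, e1⟩ := hx
  obtain ⟨h2, e2⟩ := hy
  exact Quotient.exact (e1.trans e2.symm)

theorem Represents.eq {x y : ℕ → X} {ξ η : Boundary X} (hx : Represents x ξ)
    (hy : Represents y η) (h : Asymptotic x y) : ξ = η := by
  obtain ⟨h1, e1⟩ := hx
  obtain ⟨h2, e2⟩ := hy
  rw [← e1, ← e2]
  exact Quotient.sound h

theorem Represents.of_asymptotic {x y : ℕ → X} {ξ : Boundary X} (hx : Represents x ξ)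
    (h : Asymptotic y x) : Represents y ξ := by
  have hy := hx.cauchy.of_asymptotic h
  rw [hx.eq (represents_mk hy) h.symm]
  exact represents_mk hy

theorem Represents.of_dist_le {x y : ℕ → X} {ξ : Boundary X} (hx : Represents x ξ) {r : ℝ}
    (h : ∀ n, dist (x n) (y n) ≤ r) : Represents y ξ :=
  hx.of_asymptotic (hx.cauchy.asymptotic_of_dist_le h)

theorem Represents.frequently_lt {x y : ℕ → X} {ξ η : Boundary X} (hx : Represents x ξ)
    (hy : Represents y η) (hne : ξ ≠ η) (o : X) :
    ∃ r, ∃ᶠ i in atTop, gromovProduct o (x i) (y i) < r := by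
  by_contra! hc
  refine hne (hx.eq hy ((asymptotic_iff o).2 (tendsto_atTop.2 fun r => ?_)))
  simpa only [not_frequently, not_lt] using hc r

theorem Represents.product_bounded {x y : ℕ → X} {ξ η : Boundary X} (hx : Represents x ξ)
    (hy : Represents y η) (hne : ξ ≠ η) (o : X) :
    ∃ r, ∀ᶠ i in atTop, gromovProduct o (x i) (y i) ≤ r := by
  obtain ⟨δ, hδ⟩ := exists_hypConst X
  obtain ⟨r, hr⟩ := hx.frequently_lt hy hne o
  obtain ⟨N, hN⟩ := hδ.le_of_frequently hx.cauchy hy.cauchy o hr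
  exact ⟨r + 2 * δ, eventually_atTop.2 ⟨N, fun n hn => hN n hn n hn⟩⟩

variable {G : Type*} [Group G] [MulAction G X] [IsIsometricSMul G X]

theorem Represents.smul {x : ℕ → X} {ξ : Boundary X} (h : Represents x ξ) (g : G) :
    Represents (fun n => g • x n) (g • ξ) := by
  obtain ⟨h1, rfl⟩ := h
  exact represents_mk (h1.smul g)

theorem Represents.smul_eq {x : ℕ → X} {ξ : Boundary X} (h : Represents x ξ) {g : G} {r : ℝ}
    (hg : ∀ n, dist (x n) (g • x n) ≤ r) : g • ξ = ξ :=
  (h.smul g).eq h (h.cauchy.asymptotic_of_dist_le hg)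

/-- Long tripods. -/
theorem IsNonElementary.exists_tripod (hX : IsNonElementary X) (hgeod : IsGeodesic X) (o : X) :
    ∃ K : ℝ, ∀ R : ℝ, 0 ≤ R → ∃ a b c : X, dist o a = R ∧ dist o b = R ∧ dist o c = R ∧
      gromovProduct o a b ≤ K ∧ gromovProduct o a c ≤ K ∧ gromovProduct o b c ≤ K := by
  obtain ⟨a, b, c, hab, hac, hbc⟩ := hX
  obtain ⟨x, hx⟩ := a.exists_represents
  obtain ⟨y, hy⟩ := b.exists_represents
  obtain ⟨z, hz⟩ := c.exists_represents
  obtain ⟨r₁, h₁⟩ := hx.product_bounded hy hab o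
  obtain ⟨r₂, h₂⟩ := hx.product_bounded hz hac o
  obtain ⟨r₃, h₃⟩ := hy.product_bounded hz hbc o
  refine ⟨max r₁ (max r₂ r₃), fun R hR => ?_⟩
  obtain ⟨n, k1, k2, k3, k4, k5, k6⟩ := (h₁.and (h₂.and (h₃.and
    ((tendsto_atTop.1 (hx.cauchy.tendsto_dist o) R).and
    ((tendsto_atTop.1 (hy.cauchy.tendsto_dist o) R).and
    (tendsto_atTop.1 (hz.cauchy.tendsto_dist o) R)))))).exists
  obtain ⟨a', ha, ha'⟩ := hgeod.exists_between o (x n) hR k4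
  obtain ⟨b', hb, hb'⟩ := hgeod.exists_between o (y n) hR k5
  obtain ⟨c', hc, hc'⟩ := hgeod.exists_between o (z n) hR k6
  have key : ∀ {p p' q q' : X}, dist o p' + dist p' p = dist o p →
      dist o q' + dist q' q = dist o q → gromovProduct o p' q' ≤ gromovProduct o p q := by
    intro p p' q q' hp hq
    refine (gromovProduct_mono_geodesic hp q').trans ?_
    rw [gromovProduct_comm o p q', gromovProduct_comm o p q]
    exact gromovProduct_mono_geodesic hq p
  exact ⟨a', b', c', ha, hb, hc,
    ((key ha' hb').trans k1).trans (le_max_left _ _),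
    ((key ha' hc').trans k2).trans ((le_max_left _ _).trans (le_max_right _ _)),
    ((key hb' hc').trans k3).trans ((le_max_right _ _).trans (le_max_right _ _))⟩

end BoundaryPoints

/-! ### Averaging Lipschitz functions with an invariant mean -/

section Averaging

open BoundedContinuousFunction

variable {X : Type*} [MetricSpace X] {M : Type*} [Group M] [MulAction M X]

theorem abs_sub_le_of_lipschitz {f : X → ℝ} (hf : ∀ y z, f y - f z ≤ dist y z) (y z : X) :
    |f y - f z| ≤ dist y z :=
  abs_le.2 ⟨by linarith [hf z y, dist_comm y z], hf y z⟩

theorem continuous_of_sub_le_dist {f : X → ℝ} (hf : ∀ y z, f y - f z ≤ dist y z) :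
    Continuous f :=
  (LipschitzWith.of_dist_le_mul (K := 1) fun y z => by
    simpa [Real.dist_eq] using abs_sub_le_of_lipschitz hf y z).continuous

/-- The average of the translates of a `1`-Lipschitz function under an invariant mean is
equivariant up to additive constants. -/
theorem IsAmenable.exists_average [TopologicalSpace M] [IsTopologicalGroup M]
    [IsIsometricSMul M X] [ContinuousSMul M X]
    (hM : IsAmenable M) (x₀ : X) {f : X → ℝ} (hf : ∀ y z, f y - f z ≤ dist y z) :
    ∃ (F : X → ℝ) (κ : M → ℝ), (∀ h y, F (h • y) = F y + κ h) ∧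
      ∀ (a b c o : X) (L : ℝ),
        (∀ g : M, L ≤ f (g • a) + f (g • b) + f (g • c) - 3 * f (g • o)) →
          L ≤ F a + F b + F c - 3 * F o := by
  obtain ⟨m, m1, mpos, minv⟩ := hM
  have hfc := continuous_of_sub_le_dist hf
  -- `f` itself is unbounded along orbits; only differences can be averaged. The inverse makes `D (h
  -- • y) (h • z)` a left translate of `D y z`.
  let D : X → X → (M →ᵇ ℝ) := fun y z =>
    BoundedContinuousFunction.ofNormedAddCommGroup (fun g : M => f (g⁻¹ • y) - f (g⁻¹ • z))
      ((hfc.comp (continuous_inv.smul continuous_const)).sub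
        (hfc.comp (continuous_inv.smul continuous_const))) (dist y z) fun g => by
      rw [Real.norm_eq_abs, ← dist_smul g⁻¹ y z]
      exact abs_sub_le_of_lipschitz hf _ _
  have hD : ∀ y z g, D y z g = f (g⁻¹ • y) - f (g⁻¹ • z) := fun _ _ _ => rfl
  have hsub : ∀ y z, m (D y z) = m (D y x₀) - m (D z x₀) := fun y z => by
    rw [← map_sub]
    congr 1
    ext g
    simp only [BoundedContinuousFunction.coe_sub, Pi.sub_apply, hD]
    ring
  have hinv : ∀ (h : M) y z, m (D (h • y) (h • z)) = m (D y z) := fun h y z => by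
    rw [← minv h (D y z)]
    congr 1
    ext g
    simp [hD, mul_smul]
  refine ⟨fun y => m (D y x₀), fun h => m (D (h • x₀) x₀), fun h y => ?_, ?_⟩
  · have h1 := hinv h y x₀
    rw [hsub] at h1
    linarith
  · intro a b c o L hL
    have h1 : 0 ≤ m (D a o + D b o + D c o - L • BoundedContinuousFunction.const M 1) := by
      refine mpos _ fun g => ?_
      have := hL g⁻¹
      simp [hD]
      linarith
    rw [map_sub, map_add, map_add, map_smul, m1, hsub a, hsub b, hsub c] at h1
    simp at h1
    linarith

end Averaging

/-! ### The character of an equivariant function -/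

section Characters

variable {X : Type*} {M : Type*} [Group M] [MulAction M X]
  {F : X → ℝ} {κ : M → ℝ}

theorem equivariant_mul [Nonempty X] (h : ∀ g y, F (g • y) = F y + κ g) (g k : M) :
    κ (g * k) = κ g + κ k := by
  obtain ⟨y⟩ := ‹Nonempty X›
  have h1 := h (g * k) y
  rw [mul_smul, h, h] at h1
  linarith

theorem equivariant_one [Nonempty X] (h : ∀ g y, F (g • y) = F y + κ g) : κ 1 = 0 := by
  have := equivariant_mul h 1 1
  rw [mul_one] at this
  linarith

theorem equivariant_inv [Nonempty X] (h : ∀ g y, F (g • y) = F y + κ g) (g : M) :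
    κ g⁻¹ = -κ g := by
  have := equivariant_mul h g⁻¹ g
  rw [inv_mul_cancel, equivariant_one h] at this
  linarith

theorem equivariant_pow [Nonempty X] (h : ∀ g y, F (g • y) = F y + κ g) (g : M) (n : ℕ) :
    κ (g ^ n) = n * κ g := by
  induction n with
  | zero => simp [equivariant_one h]
  | succ n ih =>
    rw [pow_succ, equivariant_mul h, ih]
    push_cast
    ring

/-- A nontrivial character takes arbitrarily negative values. -/
theorem exists_lt_of_ne_zero [Nonempty X] (h : ∀ g y, F (g • y) = F y + κ g) {g : M}
    (hg : κ g ≠ 0) (r : ℝ) : ∃ k : M, κ k < -r := by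
  obtain ⟨n, hn⟩ := exists_nat_gt (r / |κ g|)
  have hp : 0 < |κ g| := abs_pos.2 hg
  rw [div_lt_iff₀ hp] at hn
  rcases abs_cases (κ g) with ⟨e, _⟩ | ⟨e, _⟩
  · refine ⟨g⁻¹ ^ n, ?_⟩
    rw [equivariant_pow h, equivariant_inv h]
    rw [e] at hn
    linarith
  · refine ⟨g ^ n, ?_⟩
    rw [equivariant_pow h]
    rw [e] at hn
    linarith

end Characters

/-! ### A fixed point on the boundary -/

section FixedPoint

variable {X : Type*} [MetricSpace X]

theorem dist_eq_gromovProduct (o y z : X) :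
    dist y z = dist o y + dist o z - 2 * gromovProduct o y z := by
  unfold gromovProduct
  ring

/-- At most one of the products of `z` with `a`, `b`, `c` exceeds `K + δ`, and that one is at most
`R`. So of the `3R` gained by leaving `o`, at most `2R + 4(K + δ)` is lost. -/
theorem IsHypConst.tripod_le {δ : ℝ} (hδ : IsHypConst X δ) {o a b c : X} {R K : ℝ}
    (ha : dist o a = R) (hb : dist o b = R) (hc : dist o c = R)
    (hab : gromovProduct o a b ≤ K) (hac : gromovProduct o a c ≤ K)
    (hbc : gromovProduct o b c ≤ K) (z : X) :
    R - 4 * (K + δ) ≤ dist a z + dist b z + dist c z - 3 * dist o z := by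
  have h1 := hδ o a b z
  have h2 := hδ o a c z
  have h3 := hδ o b c z
  have l1 := gromovProduct_le_left o a z
  have l2 := gromovProduct_le_left o b z
  have l3 := gromovProduct_le_left o c z
  rw [gromovProduct_comm o z] at h1 h2 h3
  rw [dist_eq_gromovProduct o a z, dist_eq_gromovProduct o b z, dist_eq_gromovProduct o c z]
  rcases min_cases (gromovProduct o a z) (gromovProduct o b z) with ⟨e1, f1⟩ | ⟨e1, f1⟩ <;>
  rcases min_cases (gromovProduct o a z) (gromovProduct o c z) with ⟨e2, f2⟩ | ⟨e2, f2⟩ <;>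
  rcases min_cases (gromovProduct o b z) (gromovProduct o c z) with ⟨e3, f3⟩ | ⟨e3, f3⟩ <;>
  rw [e1] at h1 <;> rw [e2] at h2 <;> rw [e3] at h3 <;> linarith

/-- Near-convexity of the distance to `z`: the smaller of `(a|z)`, `(b|z)` is at most `(a|b) + δ`.
The bound does not involve `z`, so it survives averaging; read backwards, it bounds `(a|b)` from
below. -/
theorem IsHypConst.sum_dist_ge {δ : ℝ} (hδ : IsHypConst X δ) (o a b z : X) :
    -|dist o a - dist o b| - 2 * gromovProduct o a b - 2 * δ ≤
      dist a z + dist b z - 2 * dist o z := by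
  have h1 := hδ o a b z
  have l1 := gromovProduct_le_left o a z
  have l2 := gromovProduct_le_left o b z
  rw [gromovProduct_comm o z] at h1
  rw [dist_eq_gromovProduct o a z, dist_eq_gromovProduct o b z]
  have := le_abs_self (dist o a - dist o b)
  have := neg_abs_le (dist o a - dist o b)
  rcases min_cases (gromovProduct o a z) (gromovProduct o b z) with ⟨e1, f1⟩ | ⟨e1, f1⟩ <;>
  rw [e1] at h1 <;> linarith

/-- A sequence whose consecutive Gromov products grow fast is Cauchy-Gromov. -/
theorem IsHypConst.isCauchyGromov_of_linear {δ : ℝ} (hδ : IsHypConst X δ) {x : ℕ → X} (o : X)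
    {s E : ℝ} (hs : δ ≤ s) (hs' : 0 < s)
    (h : ∀ n : ℕ, n * s - E ≤ gromovProduct o (x n) (x (n + 1)))
    (h' : ∀ n : ℕ, n * s - E ≤ dist o (x n)) : IsCauchyGromov x := by
  have h0 := hδ.nonneg o
  -- Induction on the gap with `n` free: the gain `s ≥ δ` from `n` to `n + 1` absorbs each new loss
  -- of `δ`, so the losses do not accumulate.
  have key : ∀ k n : ℕ, n * s - E - δ ≤ gromovProduct o (x n) (x (n + k)) := by
    intro k
    induction k with
    | zero =>
      intro n
      rw [add_zero, gromovProduct_self]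
      linarith [h' n]
    | succ k ih =>
      intro n
      have h2 := ih (n + 1)
      rw [show n + 1 + k = n + (k + 1) by ring] at h2
      push_cast at h2
      exact hδ.min_le o _ _ (x (n + 1)) (h n) (by linarith)
  refine (isCauchyGromov_iff o).2 fun R => ?_
  obtain ⟨N, hN⟩ := exists_nat_gt ((R + E + δ) / s)
  rw [div_lt_iff₀ hs'] at hN
  have key2 : ∀ n ≥ N, ∀ m ≥ n, R ≤ gromovProduct o (x n) (x m) := by
    intro n hn m hm
    obtain ⟨k, rfl⟩ := Nat.exists_eq_add_of_le hm
    have h3 : (N : ℝ) * s ≤ n * s := by gcongr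
    linarith [key k n]
  refine ⟨N, fun n hn m hm => ?_⟩
  rcases le_total n m with hnm | hnm
  · exact key2 n hn m hnm
  · rw [gromovProduct_comm]
    exact key2 m hm n hnm

/-- An amenable group acting coboundedly on a nonelementary geodesic hyperbolic space has a
fixed point on the boundary. -/
theorem IsAmenable.exists_fixed [IsGromovHyperbolic X] (hgeod : IsGeodesic X)
    (hX : IsNonElementary X) {M : Type*} [Group M] [TopologicalSpace M] [IsTopologicalGroup M]
    (hM : IsAmenable M) [MulAction M X] [IsIsometricSMul M X] [ContinuousSMul M X]
    (hcob : IsCobounded M X) : ∃ ξ : Boundary X, ∀ g : M, g • ξ = ξ := by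
  obtain ⟨δ, hδ⟩ := exists_hypConst X
  obtain ⟨o, -, -⟩ := id hcob
  have : Nonempty X := ⟨o⟩
  have hδ0 := hδ.nonneg o
  obtain ⟨F, κ, hF, hav⟩ := hM.exists_average o (f := fun y => dist y o)
    (fun y z => by linarith [dist_triangle y z o])
  -- Repeated points reduce the three-point inequality to one about two points.
  have hlip : ∀ y z, F y - F z ≤ dist y z := fun y z => by
    have := hav z y y y (-dist y z) fun g => by
      have := dist_triangle (g • y) (g • z) o
      rw [dist_smul] at this
      linarith
    linarith
  have hav2 : ∀ a b p, -|dist p a - dist p b| - 2 * gromovProduct p a b - 2 * δ ≤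
      F a + F b - 2 * F p := fun a b p => by
    have := hav a b p p (-|dist p a - dist p b| - 2 * gromovProduct p a b - 2 * δ) fun g => by
      have := hδ.sum_dist_ge p a b (g⁻¹ • o)
      rw [← dist_smul g a, ← dist_smul g b, ← dist_smul g p (g⁻¹ • o), smul_inv_smul] at this
      linarith
    linarith
  -- Otherwise `F` is invariant, hence within `r` of `F o` by coboundedness, and a tripod whose
  -- length beats `3r` plus the error terms is a contradiction.
  have hne : ∃ g, κ g ≠ 0 := by
    by_contra! h0
    obtain ⟨r, hr⟩ := hcob.exists_radius o
    have hbd : ∀ y, |F y - F o| ≤ r := fun y => by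
      obtain ⟨g, hg⟩ := hr y
      have h1 := hF g o
      rw [h0, add_zero] at h1
      rw [← h1]
      exact (abs_sub_le_of_lipschitz hlip _ _).trans hg
    obtain ⟨K, hK⟩ := hX.exists_tripod hgeod o
    have hr0 : 0 ≤ r := (abs_nonneg _).trans (hbd o)
    obtain ⟨a, b, c, ha, hb, hc, hab, hac, hbc⟩ := hK (4 * (|K| + δ) + 3 * r + 1) (by positivity)
    have h1 := hav a b c o _ fun g => by
      have := hδ.tripod_le ha hb hc hab hac hbc (g⁻¹ • o)
      rwa [← dist_smul g a, ← dist_smul g b, ← dist_smul g c, ← dist_smul g o (g⁻¹ • o),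
        smul_inv_smul] at this
    have := (abs_le.1 (hbd a)).2
    have := (abs_le.1 (hbd b)).2
    have := (abs_le.1 (hbd c)).2
    have := le_abs_self K
    linarith
  obtain ⟨g₀, hg₀⟩ := hne
  -- The drift must exceed `δ` for `isCauchyGromov_of_linear`.
  obtain ⟨g, hg⟩ := exists_lt_of_ne_zero hF hg₀ (δ + 1)
  have hFn : ∀ n : ℕ, F (g ^ n • o) = F o + n * κ g := fun n => by rw [hF, equivariant_pow hF]
  have hmove : ∀ (h : M) (n : ℕ), |dist o (g ^ n • o) - dist o (h • g ^ n • o)| ≤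
      dist o (h • o) := fun h n => by
    rw [← dist_smul h o (g ^ n • o), dist_comm o (h • o)]
    exact abs_dist_sub_le (h • o) o (h • g ^ n • o)
  -- Both points have very low `F`-value, so near-convexity at `o` forces a large product. The case
  -- `h = g` gives convergence of the orbit; general `h` shows that `h` fixes the limit.
  have hprod : ∀ (h : M) (n : ℕ), n * (-κ g) - κ h / 2 - dist o (h • o) / 2 - δ ≤
      gromovProduct o (g ^ n • o) (h • g ^ n • o) := fun h n => by
    have h1 := hav2 (g ^ n • o) (h • g ^ n • o) o
    rw [hF h, hFn] at h1
    linarith [hmove h n]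
  have hdist : ∀ n : ℕ, n * (-κ g) ≤ dist o (g ^ n • o) := fun n => by
    have := hlip o (g ^ n • o)
    rw [hFn] at this
    linarith
  have hcg : IsCauchyGromov (fun n => g ^ n • o) := by
    refine hδ.isCauchyGromov_of_linear o (s := -κ g)
      (E := |κ g / 2 + dist o (g • o) / 2 + δ|) (by linarith) (by linarith) (fun n => ?_)
      (fun n => ?_)
    · have := hprod g n
      rw [pow_succ', mul_smul]
      linarith [le_abs_self (κ g / 2 + dist o (g • o) / 2 + δ)]
    · linarith [hdist n, abs_nonneg (κ g / 2 + dist o (g • o) / 2 + δ)]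
  refine ⟨_, fun h => ((represents_mk hcg).smul h).eq (represents_mk hcg) ?_⟩
  refine Asymptotic.symm ((asymptotic_iff o).2 ?_)
  refine tendsto_atTop_mono (hprod h) ?_
  have : Tendsto (fun n : ℕ => (n : ℝ) * (-κ g)) atTop atTop :=
    tendsto_natCast_atTop_atTop.atTop_mul_const (by linarith)
  simpa only [sub_eq_add_neg, add_assoc] using
    tendsto_atTop_add_const_right _ (-(κ h / 2) + (-(dist o (h • o) / 2) + -δ)) this

end FixedPoint

/-! ### Horokernels and horofunctions -/

section Horofunctions

variable {X : Type*} [MetricSpace X] [IsGromovHyperbolic X]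

/-- `B` is, up to the error `C`, a horofunction (Busemann function) at `ξ`. -/
def IsHorofunction (ξ : Boundary X) (B : X → ℝ) (C : ℝ) : Prop :=
  ∀ x : ℕ → X, Represents x ξ → ∀ y z : X,
    ∀ᶠ n in atTop, |(dist y (x n) - dist z (x n)) - (B y - B z)| ≤ C

/-- Horokernels are determined up to `2δ` by their base point. -/
theorem IsHorokernel.close {δ : ℝ} (hδ : IsHypConst X δ) {ξ : Boundary X} {h : X × X → ℝ}
    (hh : IsHorokernel ξ h) {ε : ℝ} (hε : 0 < ε) {x : ℕ → X} (hx : Represents x ξ) (p q : X) :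
    ∀ᶠ n in atTop, |h (p, q) - (dist p (x n) - dist q (x n))| ≤ 2 * δ + ε := by
  obtain ⟨x', hx', hcl⟩ := hh
  have hev : ∃ᶠ n in atTop, |h (p, q) - (dist p (x' n) - dist q (x' n))| < ε := by
    have h1 : {k : X × X → ℝ | |h (p, q) - k (p, q)| < ε} ∈ 𝓝 h := by
      refine IsOpen.mem_nhds ?_ (by simpa using hε)
      exact isOpen_lt (continuous_const.sub (continuous_apply _)).abs continuous_const
    exact (mapClusterPt_iff_frequently.1 hcl) _ h1
  have hasym := hx.asymptotic hx'
  obtain ⟨N, hN⟩ := (isCauchyGromov_iff p).1 hx.cauchy (dist p q + δ)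
  obtain ⟨N', hN'⟩ := eventually_atTop.1 (tendsto_atTop.1 (hasym p) (dist p q + δ))
  refine eventually_atTop.2 ⟨N, fun n hn => ?_⟩
  obtain ⟨m, hm, hmε⟩ := frequently_atTop.1 hev (max N N')
  have h1 := hδ.min_le p (x n) (x' m) (x m) (hN n hn m ((le_max_left _ _).trans hm))
    (hN' m ((le_max_right _ _).trans hm))
  have h2 := hδ.dist_sub_le (p := p) (q := q) (x := x n) (x' := x' m) (by linarith)
  have h3 := hδ.dist_sub_le (p := p) (q := q) (x := x' m) (x' := x n)
    (by rw [gromovProduct_comm]; linarith)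
  rw [abs_lt] at hmε
  rw [abs_le]
  constructor <;> linarith [hmε.1, hmε.2]

theorem Boundary.exists_horokernel (ξ : Boundary X) : ∃ h : X × X → ℝ, IsHorokernel ξ h := by
  obtain ⟨x, hx⟩ := ξ.exists_represents
  have hc : IsCompact (Set.univ.pi fun p : X × X => Set.Icc (-dist p.1 p.2) (dist p.1 p.2)) :=
    isCompact_univ_pi fun p => isCompact_Icc
  obtain ⟨h, -, hh⟩ := hc.exists_mapClusterPt (f := atTop)
    (u := fun (n : ℕ) (p : X × X) => dist p.1 (x n) - dist p.2 (x n)) (by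
      rw [le_principal_iff, mem_map]
      filter_upwards with n p _
      exact abs_le.1 (abs_dist_sub_le _ _ _))
  exact ⟨h, x, hx, hh⟩

theorem IsHorokernel.sub_le {ξ : Boundary X} {h : X × X → ℝ} (hh : IsHorokernel ξ h)
    (o y z : X) : h (y, o) - h (z, o) ≤ dist y z := by
  obtain ⟨x, -, hcl⟩ := hh
  by_contra! hc
  have h1 : {k : X × X → ℝ | dist y z < k (y, o) - k (z, o)} ∈ 𝓝 h := by
    refine IsOpen.mem_nhds ?_ hc
    exact isOpen_lt continuous_const ((continuous_apply _).sub (continuous_apply _))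
  obtain ⟨n, hn⟩ := ((mapClusterPt_iff_frequently.1 hcl) _ h1).exists
  have := dist_triangle y z (x n)
  have hn' : dist y z < dist y (x n) - dist o (x n) - (dist z (x n) - dist o (x n)) := hn
  linarith

theorem IsHorokernel.isHorofunction {δ : ℝ} (hδ : IsHypConst X δ) {ξ : Boundary X}
    {h : X × X → ℝ} (hh : IsHorokernel ξ h) (o : X) :
    IsHorofunction ξ (fun y => h (y, o)) (4 * δ + 2) := by
  intro x hx y z
  filter_upwards [hh.close hδ one_pos hx y o, hh.close hδ one_pos hx z o] with n h1 h2
  rw [abs_le] at *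
  constructor <;> linarith [h1.1, h1.2, h2.1, h2.2]

/-- The fourth point of the four-point inequality is sent to `ξ`; its distances become values of
`B`. -/
theorem IsHorofunction.four_point {δ : ℝ} (hδ : IsHypConst X δ) {ξ : Boundary X} {B : X → ℝ}
    {C : ℝ} (hB : IsHorofunction ξ B C) (y z w : X) :
    dist y z + B w ≤ max (dist y w + B z) (dist z w + B y) + (2 * δ + C) := by
  obtain ⟨x, hx⟩ := ξ.exists_represents
  obtain ⟨n, h1, h2⟩ := ((hB x hx w z).and (hB x hx w y)).exists
  have h3 := hδ.four_point y z w (x n)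
  rw [abs_le] at h1 h2
  rcases le_total (dist y w + dist z (x n)) (dist z w + dist y (x n)) with h | h
  · rw [max_eq_right h] at h3
    have := le_max_right (dist y w + B z) (dist z w + B y)
    linarith [h2.1, h2.2]
  · rw [max_eq_left h] at h3
    have := le_max_left (dist y w + B z) (dist z w + B y)
    linarith [h1.1, h1.2]

/-- The dictionary between `B` and the boundary: `d(o,y) + B o - B y` is twice the Gromov product of
`y` and `ξ`, up to `C`. -/
theorem IsHorofunction.gromovProduct_ge {ξ : Boundary X} {B : X → ℝ} {C : ℝ}
    (hB : IsHorofunction ξ B C) {x : ℕ → X} (hx : Represents x ξ) (o y : X) :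
    ∀ᶠ n in atTop, |2 * gromovProduct o y (x n) - (dist o y + B o - B y)| ≤ C := by
  filter_upwards [hB x hx o y] with n hn
  unfold gromovProduct
  rwa [show 2 * ((dist o y + dist o (x n) - dist y (x n)) / 2) - (dist o y + B o - B y) =
    dist o (x n) - dist y (x n) - (B o - B y) by ring]

/-- Sequences whose Gromov product with `ξ` goes to infinity converge to `ξ`. -/
theorem IsHorofunction.represents {ξ : Boundary X} {B : X → ℝ} {C : ℝ}
    (hB : IsHorofunction ξ B C) (o : X) {y : ℕ → X}
    (hy : Tendsto (fun n => dist o (y n) + B o - B (y n)) atTop atTop) : Represents y ξ := by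
  obtain ⟨δ, hδ⟩ := exists_hypConst X
  obtain ⟨x, hx⟩ := ξ.exists_represents
  refine hx.of_asymptotic ((asymptotic_iff o).2 (tendsto_atTop.2 fun R => ?_))
  obtain ⟨N, hN⟩ := (isCauchyGromov_iff o).1 hx.cauchy (R + δ)
  filter_upwards [tendsto_atTop.1 hy (2 * (R + δ) + C), eventually_ge_atTop N] with n hn hnN
  obtain ⟨m, hm, hmN⟩ := ((hB.gromovProduct_ge hx o (y n)).and (eventually_ge_atTop N)).exists
  have h1 := hδ.min_le o (y n) (x n) (x m) (r := R + δ) (by linarith [(abs_le.1 hm).1])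
    (hN m hmN n hnN)
  linarith

theorem IsHorofunction.represents_of_tendsto {ξ : Boundary X} {B : X → ℝ} {C : ℝ}
    (hB : IsHorofunction ξ B C) (o : X) {y : ℕ → X}
    (hy : Tendsto (fun n => B (y n)) atTop atBot) : Represents y ξ := by
  refine hB.represents o (tendsto_atTop_mono (f := fun n => B o + -B (y n)) (fun n => ?_)
    (tendsto_atTop_add_const_left _ _ (tendsto_neg_atBot_atTop.comp hy)))
  linarith [dist_nonneg (x := o) (y := y n)]

/-- The gap `dist o (y n) - (B (y n) - B o)` stays bounded, with an explicit bound, for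
sequences whose Gromov product with a sequence representing `ξ` does not become large. -/
theorem IsHorofunction.eventually_le {δ : ℝ} (hδ : IsHypConst X δ) {ξ : Boundary X} {B : X → ℝ}
    {C : ℝ} (hB : IsHorofunction ξ B C) {x y : ℕ → X} (hx : Represents x ξ)
    (hy : IsCauchyGromov y) (o : X) {r : ℝ}
    (h : ∃ᶠ i in atTop, gromovProduct o (y i) (x i) < r) :
    ∀ᶠ n in atTop, dist o (y n) ≤ B (y n) - B o + (2 * (r + 2 * δ) + C) := by
  obtain ⟨N, hN⟩ := hδ.le_of_frequently hy hx.cauchy o h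
  filter_upwards [eventually_ge_atTop N] with n hn
  obtain ⟨m, hm, hmN⟩ := ((hB.gromovProduct_ge hx o (y n)).and (eventually_ge_atTop N)).exists
  have := hN n hn m hmN
  linarith [(abs_le.1 hm).1]

theorem IsHorofunction.exists_forall_represents {ξ : Boundary X} {B : X → ℝ} {C : ℝ}
    (hB : IsHorofunction ξ B C) {η : Boundary X} (hη : η ≠ ξ) (o : X) :
    ∃ E, ∀ y : ℕ → X, Represents y η → ∀ᶠ n in atTop, dist o (y n) ≤ B (y n) - B o + E := by
  obtain ⟨δ, hδ⟩ := exists_hypConst X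
  obtain ⟨x, hx⟩ := ξ.exists_represents
  obtain ⟨y₀, hy₀⟩ := η.exists_represents
  obtain ⟨r, hr⟩ := hy₀.frequently_lt hx hη o
  refine ⟨_, fun y hy => hB.eventually_le hδ hx hy.cauchy o (r := r + δ) ?_⟩
  have hδ0 := hδ.nonneg o
  refine (hr.and_eventually (tendsto_atTop.1 (hy₀.asymptotic hy o) (r + δ))).mono
    fun i ⟨h1, h2⟩ => ?_
  by_contra! hc
  have := hδ.min_le o (y₀ i) (x i) (y i) h2 hc
  linarith

/-- The complement of `K` contains a basic neighbourhood of `ξ`, whose radius bounds the products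
with `ξ` uniformly over `K`. -/
theorem IsHorofunction.exists_forall_mem {ξ : Boundary X} {B : X → ℝ} {C : ℝ}
    (hB : IsHorofunction ξ B C) {K : Set (Boundary X)} (hK : IsClosed K) (hξ : ξ ∉ K) (o : X) :
    ∃ E, ∀ η ∈ K, ∀ y : ℕ → X, Represents y η →
      ∀ᶠ n in atTop, dist o (y n) ≤ B (y n) - B o + E := by
  obtain ⟨δ, hδ⟩ := exists_hypConst X
  obtain ⟨x, hx⟩ := ξ.exists_represents
  obtain ⟨r, hr⟩ := hK.isOpen_compl ξ hξ x o hx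
  refine ⟨_, fun η hη y hy => hB.eventually_le hδ hx hy.cauchy o (r := r) ?_⟩
  by_contra hc
  rw [not_frequently] at hc
  refine hr (show η ∈ basicNhd o x r from ⟨y, hy, fun c hcr => ?_⟩) hη
  filter_upwards [hc] with i hi
  exact hcr.le.trans (not_lt.1 hi)

theorem IsHorofunction.exists_le {ξ : Boundary X} {B : X → ℝ} {C : ℝ}
    (hB : IsHorofunction ξ B C) (hgeod : IsGeodesic X) (o : X) (R : ℝ) : ∃ y, B y ≤ R := by
  obtain ⟨δ, hδ⟩ := exists_hypConst X
  obtain ⟨x, hx⟩ := ξ.exists_represents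
  -- Walking a distance `S` from `o` towards `ξ` lowers `B` by at least `S - 2δ - C`.
  set S := |B o - R| + 2 * |δ| + |C| with hS
  obtain ⟨N, hN⟩ := (isCauchyGromov_iff o).1 hx.cauchy S
  have hS0 : 0 ≤ S := by positivity
  have h1 := hN N le_rfl N le_rfl
  rw [gromovProduct_self] at h1
  obtain ⟨y, hy, hy'⟩ := hgeod.exists_between o (x N) hS0 h1
  obtain ⟨m, hm, hmN⟩ := ((hB.gromovProduct_ge hx o y).and (eventually_ge_atTop N)).exists
  have h2 : gromovProduct o y (x N) = S := by
    unfold gromovProduct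
    linarith
  have h3 := hδ.min_le o y (x m) (x N) h2.ge (hN N le_rfl m hmN)
  refine ⟨y, ?_⟩
  have := (abs_le.1 hm).2
  have := le_abs_self C
  have := le_abs_self δ
  have := le_abs_self (B o - R)
  linarith

end Horofunctions

/-! ### Equivariant horofunctions -/

section EquivariantHorofunctions

variable {X : Type*} [MetricSpace X] [IsGromovHyperbolic X] {M : Type*} [Group M]
  [MulAction M X]

/-- `B` is a `1`-Lipschitz horofunction at `ξ` that each group element changes by an additive
constant, and that satisfies the four-point inequality with `ξ` as one of the points. -/
structure IsEquivariantHorofunction (ξ : Boundary X) (B : X → ℝ) (κ : M → ℝ) (C : ℝ) :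
    Prop where
  sub_le : ∀ y z, B y - B z ≤ dist y z
  smul : ∀ g y, B (g • y) = B y + κ g
  horo : IsHorofunction ξ B C
  four_point : ∀ y z w, dist y z + B w ≤ max (dist y w + B z) (dist z w + B y) + C

/-- An amenable group fixing `ξ` preserves, up to additive constants, some horofunction. -/
theorem IsAmenable.exists_equivariantHorofunction [TopologicalSpace M] [IsTopologicalGroup M]
    [IsIsometricSMul M X] [ContinuousSMul M X] (hM : IsAmenable M) {ξ : Boundary X}
    (hξ : ∀ g : M, g • ξ = ξ) (o : X) :
    ∃ (B : X → ℝ) (κ : M → ℝ) (C : ℝ), 0 ≤ C ∧ IsEquivariantHorofunction ξ B κ C := by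
  obtain ⟨δ, hδ⟩ := exists_hypConst X
  have hδ0 := hδ.nonneg o
  obtain ⟨h, hh⟩ := ξ.exists_horokernel
  have hf := hh.isHorofunction hδ o
  obtain ⟨B, κ, hκ, hav⟩ := hM.exists_average o (hh.sub_le o)
  have hlip : ∀ y z, B y - B z ≤ dist y z := fun y z => by
    have := hav z y y y (-dist y z) fun g => by
      have := hh.sub_le o (g • y) (g • z)
      rw [dist_smul] at this
      linarith
    linarith
  -- Since `g` fixes `ξ`, each translate of `h` is again a horofunction at `ξ`, so its differences
  -- match those of `h` up to two errors `4δ + 2`; the mean keeps the bound. Exchanging `y` and `z`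
  -- gives the other side.
  have hclose : ∀ y z, -(2 * (4 * δ + 2)) ≤ (B y - B z) - (h (y, o) - h (z, o)) := fun y z => by
    obtain ⟨x, hx⟩ := ξ.exists_represents
    have := hav y z z z (h (y, o) - h (z, o) - 2 * (4 * δ + 2)) fun g => by
      have hgx := hx.smul g⁻¹
      rw [hξ] at hgx
      obtain ⟨n, h1, h2⟩ := ((hf x hx (g • y) (g • z)).and (hf _ hgx y z)).exists
      have e : ∀ p : X, dist p (g⁻¹ • x n) = dist (g • p) (x n) := fun p => by
        rw [← dist_smul g p, smul_inv_smul]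
      rw [e, e] at h2
      rw [abs_le] at h1 h2
      linarith [h1.1, h1.2, h2.1, h2.2]
    linarith
  have hB : IsHorofunction ξ B (3 * (4 * δ + 2)) := fun x hx y z => by
    filter_upwards [hf x hx y z] with n hn
    have h1 := hclose y z
    have h2 := hclose z y
    rw [abs_le] at hn ⊢
    constructor <;> linarith [hn.1, hn.2]
  refine ⟨B, κ, 2 * δ + 3 * (4 * δ + 2), by positivity, hlip, hκ, fun x hx y z => ?_,
    hB.four_point hδ⟩
  filter_upwards [hB x hx y z] with n hn
  linarith

end EquivariantHorofunctions

section Topological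

theorem mem_of_mapClusterPt {ι Y : Type*} [TopologicalSpace Y] {l : Filter ι} {u : ι → Y} {y : Y}
    (h : MapClusterPt y l u) {s : Set Y} (hs : IsClosed s) (hu : ∀ᶠ i in l, u i ∈ s) : y ∈ s :=
  isClosed_iff_clusterPt.1 hs y (ClusterPt.mono h (le_principal_iff.2 hu))

theorem IsMetricallyProper.isCompact_setOf_dist_le {G : Type*} [Group G] [TopologicalSpace G]
    {X : Type*} [MetricSpace X] [MulAction G X] (h : IsMetricallyProper G X) (o : X) (R : ℝ) :
    IsCompact {g : G | dist o (g • o) ≤ R} := by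
  have h1 := (h o).isCompact_preimage (isCompact_Icc (a := 0) (b := R))
  convert h1 using 1
  ext g
  exact ⟨fun hg => ⟨dist_nonneg, hg⟩, fun hg => hg.2⟩

theorem tendsto_natCast_mul_neg {c : ℝ} (hc : c < 0) :
    Tendsto (fun n : ℕ => (n : ℝ) * -c) atTop atTop :=
  tendsto_natCast_atTop_atTop.atTop_mul_const (by linarith)

end Topological

section Isometries

variable {X : Type*} [MetricSpace X] {M : Type*} [Group M] [MulAction M X] [IsIsometricSMul M X]

theorem dist_conj (o : X) (α g : M) (n : ℕ) :
    dist o (((α ^ n)⁻¹ * g * α ^ n) • o) = dist (α ^ n • o) (g • α ^ n • o) := by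
  rw [← dist_smul (α ^ n) o, mul_smul, mul_smul, smul_inv_smul]

theorem dist_inv_iterate (o : X) (α : M) {i j : ℕ} (hij : i ≤ j) :
    dist ((α ^ i)⁻¹ • o) ((α ^ j)⁻¹ • o) = dist o (α ^ (j - i) • o) := by
  obtain ⟨k, rfl⟩ := Nat.exists_eq_add_of_le hij
  rw [← dist_smul (α ^ (i + k)) ((α ^ i)⁻¹ • o), smul_inv_smul, smul_smul, add_tsub_cancel_left,
    add_comm i k, pow_add, mul_inv_cancel_right, dist_comm]

end Isometries

/-! ### Rays towards the fixed point, and hyperbolic elements -/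

namespace IsEquivariantHorofunction

section Rays

variable {X : Type*} [MetricSpace X] [IsGromovHyperbolic X] {M : Type*} [Group M]
  [MulAction M X] {ξ : Boundary X} {B : X → ℝ} {κ : M → ℝ} {C : ℝ}

/-- Far enough down, a ray from `z` has merged with the rays from `y`, so `z'` may be viewed as
lying on a ray from `y`. -/
theorem dist_le_of_ray (H : IsEquivariantHorofunction ξ B κ C) {y z z' : X} {E : ℝ}
    (h : dist z z' ≤ B z - B z' + E) (h' : dist y z + 2 * B z' ≤ B y + B z + E) :
    dist y z' ≤ B y - B z' + (E + C) := by
  have h1 := H.four_point z' y z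
  have h2 : max (dist z' z + B y) (dist y z + B z') ≤ B z - B z' + E + B y :=
    max_le (by linarith [dist_comm z z']) (by linarith)
  linarith [dist_comm z' y]

theorem dist_le_of_rays (H : IsEquivariantHorofunction ξ B κ C) {y y' z' : X} {E : ℝ}
    (h : dist y y' ≤ B y - B y' + E) (h' : dist y z' ≤ B y - B z' + E) :
    dist y' z' ≤ |B y' - B z'| + (E + C) := by
  have h1 := H.four_point y' z' y
  have h2 : max (dist y' y + B z') (dist z' y + B y') ≤ B y + |B y' - B z'| + E :=
    max_le (by linarith [dist_comm y y', neg_abs_le (B y' - B z')])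
      (by linarith [dist_comm y z', le_abs_self (B y' - B z')])
  linarith

theorem apply_eq (H : IsEquivariantHorofunction ξ B κ C) (o : X) (g : M) :
    κ g = B (g • o) - B o := by
  linarith [H.smul g o]

theorem neg_le_dist (H : IsEquivariantHorofunction ξ B κ C) (o : X) (g : M) :
    -κ g ≤ dist o (g • o) := by
  rw [H.apply_eq o]
  linarith [H.sub_le o (g • o)]

theorem represents_iterate (H : IsEquivariantHorofunction ξ B κ C) (o : X) {α : M}
    (hα : κ α < 0) : Represents (fun n : ℕ => α ^ n • o) ξ := by
  have : Nonempty X := ⟨o⟩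
  refine H.horo.represents_of_tendsto o ?_
  have h1 := tendsto_atBot_add_const_left _ (B o)
    (tendsto_neg_atTop_atBot.comp (tendsto_natCast_mul_neg hα))
  refine h1.congr fun n => ?_
  rw [H.smul, equivariant_pow H.smul]
  simp

theorem mem_endpoints (H : IsEquivariantHorofunction ξ B κ C) (o : X) {g : M}
    (hg : κ g ≠ 0) : ξ ∈ endpoints X g := by
  have : Nonempty X := ⟨o⟩
  rcases lt_or_gt_of_ne hg with h | h
  · exact ⟨fun n => g ^ n, o, fun n => Subgroup.npow_mem_zpowers g n, H.represents_iterate o h⟩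
  · refine ⟨fun n => g⁻¹ ^ n, o, fun n => ?_, H.represents_iterate o ?_⟩
    · exact pow_mem (inv_mem (Subgroup.mem_zpowers g)) n
    · rw [equivariant_inv H.smul]
      linarith

variable [IsIsometricSMul M X]

/-- When one step descends by at least `C / 2`, the induction hypothesis keeps the first term of the
maximum below the second, so the error `C` does not accumulate. -/
theorem iterate_le_of_large (H : IsEquivariantHorofunction ξ B κ C) (hC : 0 ≤ C) (o : X) {α : M}
    (hα : C ≤ 2 * -κ α) (n : ℕ) :
    dist o (α ^ n • o) ≤ n * -κ α + (dist o (α • o) + κ α + C) := by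
  have : Nonempty X := ⟨o⟩
  induction n with
  | zero =>
    simp only [pow_zero, one_smul, dist_self, Nat.cast_zero, zero_mul, zero_add]
    linarith [H.neg_le_dist o α]
  | succ n ih =>
    have h1 := H.four_point o (α ^ (n + 1) • o) (α ^ n • o)
    have h2 : dist (α ^ (n + 1) • o) (α ^ n • o) = dist o (α • o) := by
      rw [pow_succ, mul_smul, dist_smul, dist_comm]
    rw [h2, H.smul, H.smul, equivariant_pow H.smul, equivariant_pow H.smul] at h1
    have h3 : max (dist o (α ^ n • o) + (B o + ((n + 1 : ℕ) : ℝ) * κ α)) (dist o (α • o) + B o) ≤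
        dist o (α • o) + B o := by
      refine max_le ?_ le_rfl
      push_cast
      linarith
    push_cast at h1 h3 ⊢
    linarith

theorem exists_iterate_le (H : IsEquivariantHorofunction ξ B κ C) (hC : 0 ≤ C) (o : X) {α : M}
    (hα : κ α < 0) : ∃ E, ∀ n : ℕ, dist o (α ^ n • o) ≤ n * -κ α + E := by
  have : Nonempty X := ⟨o⟩
  -- A power `α ^ N` descends enough for the previous lemma; the remainder modulo `N` costs a
  -- bounded amount.
  obtain ⟨N, hN⟩ := exists_nat_gt (C / -κ α)
  have hN0 : 0 < N := by
    have : (0 : ℝ) < N := (div_nonneg hC (by linarith)).trans_lt hN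
    exact_mod_cast this
  rw [div_lt_iff₀ (by linarith)] at hN
  have h1 := H.iterate_le_of_large hC o (α := α ^ N)
    (by rw [equivariant_pow H.smul]; linarith)
  have hD : ∀ i : ℕ, dist o (α ^ i • o) ≤ i * dist o (α • o) := fun i => by
    induction i with
    | zero => simp
    | succ i ih =>
      have h2 := dist_triangle o (α ^ i • o) (α ^ (i + 1) • o)
      rw [pow_succ, mul_smul, dist_smul] at h2
      rw [pow_succ, mul_smul]
      push_cast
      linarith
  refine ⟨dist o (α ^ N • o) + κ (α ^ N) + C + N * dist o (α • o), fun n => ?_⟩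
  have h2 := h1 (n / N)
  rw [equivariant_pow H.smul α N] at h2 ⊢
  have h3 := dist_triangle o ((α ^ N) ^ (n / N) • o) (α ^ n • o)
  have h4 : α ^ n = (α ^ N) ^ (n / N) * α ^ (n % N) := by
    rw [← pow_mul, ← pow_add, Nat.div_add_mod]
  have h5 : dist ((α ^ N) ^ (n / N) • o) (α ^ n • o) = dist o (α ^ (n % N) • o) := by
    conv_lhs => rw [h4, mul_smul, dist_smul]
  have h6 : ((n % N : ℕ) : ℝ) * dist o (α • o) ≤ N * dist o (α • o) := by
    gcongr
    exact (Nat.mod_lt n hN0).le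
  have h7 : ((n / N : ℕ) : ℝ) * (N * -κ α) ≤ n * -κ α := by
    rw [← mul_assoc]
    refine mul_le_mul_of_nonneg_right ?_ (by linarith)
    exact_mod_cast Nat.div_mul_le_self n N
  have := hD (n % N)
  linarith

/-- Conjugating far enough along the orbit of an element that translates towards `ξ` makes
displacements bounded. -/
theorem exists_eventually_dist_le (H : IsEquivariantHorofunction ξ B κ C) (hC : 0 ≤ C) (o : X)
    {α : M} (hα : κ α < 0) : ∃ E, ∀ g : M, ∀ᶠ n : ℕ in atTop,
      dist (α ^ n • o) (g • α ^ n • o) ≤ |κ g| + E := by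
  have : Nonempty X := ⟨o⟩
  obtain ⟨E, hE⟩ := H.exists_iterate_le hC o hα
  refine ⟨E + C + C, fun g => ?_⟩
  have hE0 : 0 ≤ E := by simpa using hE 0
  have hBn : ∀ n : ℕ, B (α ^ n • o) = B o + n * κ α := fun n => by
    rw [H.smul, equivariant_pow H.smul]
  -- For such `n`, `g • α ^ n • o` is low enough for `dist_le_of_ray` to move the start of its ray
  -- from `g • o` to `o`.
  filter_upwards [tendsto_atTop.1 (tendsto_natCast_mul_neg hα) (dist o (g • o) + |κ g|)]
    with n hn
  have h1 : dist (g • o) (g • α ^ n • o) ≤ B (g • o) - B (g • α ^ n • o) + E := by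
    rw [dist_smul, H.smul g, H.smul g, hBn]
    linarith [hE n]
  have h2 := H.dist_le_of_ray (y := o) h1 (by
    rw [H.smul g, H.smul g, hBn]
    linarith [le_abs_self (κ g), abs_nonneg (κ g), dist_nonneg (x := o) (y := g • o)])
  have h3 := H.dist_le_of_rays (y := o) (y' := α ^ n • o) (z' := g • α ^ n • o) (E := E + C)
    (by rw [hBn]; linarith [hE n]) h2
  refine h3.trans (le_of_eq ?_)
  rw [H.smul g, show B (α ^ n • o) - (B (α ^ n • o) + κ g) = -κ g by ring, abs_neg]

theorem exists_apply_neg (H : IsEquivariantHorofunction ξ B κ C) (hgeod : IsGeodesic X)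
    (hcob : IsCobounded M X) (o : X) : ∃ α : M, κ α < 0 := by
  obtain ⟨r, hr⟩ := hcob.exists_radius o
  obtain ⟨y, hy⟩ := H.horo.exists_le hgeod o (B o - r - 1)
  obtain ⟨g, hg⟩ := hr y
  refine ⟨g, ?_⟩
  rw [H.apply_eq o]
  linarith [H.sub_le (g • o) y, dist_comm y (g • o)]

theorem isCauchyGromov_inv_iterate (H : IsEquivariantHorofunction ξ B κ C) (hC : 0 ≤ C) (o : X)
    {α : M} (hα : κ α < 0) : IsCauchyGromov (fun n : ℕ => (α ^ n)⁻¹ • o) := by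
  have : Nonempty X := ⟨o⟩
  obtain ⟨E, hE⟩ := H.exists_iterate_le hC o hα
  have key : ∀ i j : ℕ, i ≤ j →
      i * -κ α - E / 2 ≤ gromovProduct o ((α ^ i)⁻¹ • o) ((α ^ j)⁻¹ • o) := by
    intro i j hij
    have hd : ∀ n : ℕ, n * -κ α ≤ dist o ((α ^ n)⁻¹ • o) := fun n => by
      have := H.neg_le_dist ((α ^ n)⁻¹ • o) (α ^ n)
      rw [smul_inv_smul, dist_comm, equivariant_pow H.smul] at this
      linarith
    have h1 := hE (j - i)
    rw [← dist_inv_iterate o α hij, Nat.cast_sub hij] at h1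
    unfold gromovProduct
    linarith [hd i, hd j]
  refine (isCauchyGromov_iff o).2 fun R => ?_
  obtain ⟨N, hN⟩ := eventually_atTop.1 (tendsto_atTop.1 (tendsto_natCast_mul_neg hα) (R + E / 2))
  refine ⟨N, fun n hn m hm => ?_⟩
  rcases le_total n m with h | h
  · linarith [key n m h, hN n hn]
  · rw [gromovProduct_comm]
    linarith [key m n h, hN m hm]

theorem isHyperbolicElement (H : IsEquivariantHorofunction ξ B κ C) (hC : 0 ≤ C) (o : X)
    {α : M} (hα : κ α < 0) : IsHyperbolicElement X α := by
  have : Nonempty X := ⟨o⟩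
  obtain ⟨E, hE⟩ := H.exists_iterate_le hC o hα
  refine ⟨o, -κ α, by linarith, ?_⟩
  have h1 : Tendsto (fun n : ℕ => -κ α + E / n) atTop (𝓝 (-κ α)) := by
    simpa using tendsto_const_nhds.add (tendsto_const_div_atTop_nhds_zero_nat E)
  refine tendsto_of_tendsto_of_tendsto_of_le_of_le' tendsto_const_nhds h1 ?_ ?_
  · filter_upwards [eventually_gt_atTop 0] with n hn
    rw [le_div_iff₀ (by exact_mod_cast hn)]
    have := H.neg_le_dist o (α ^ n)
    rw [equivariant_pow H.smul] at this
    linarith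
  · filter_upwards [eventually_gt_atTop 0] with n hn
    have hn' : (0 : ℝ) < n := by exact_mod_cast hn
    rw [div_le_iff₀ hn', add_mul, div_mul_cancel₀ _ hn'.ne']
    linarith [hE n]

/-- If `κ g = 0`, every power `g ^ n` displaces some point by at most a constant `E` independent of
`n`. Its translation length `n * l` is then at most `E` for all `n`, which contradicts `l > 0`. -/
theorem apply_ne_zero (H : IsEquivariantHorofunction ξ B κ C) (hC : 0 ≤ C)
    {α : M} (hα : κ α < 0) {g : M} (hg : IsHyperbolicElement X g) : κ g ≠ 0 := by
  intro h0
  obtain ⟨o, l, hl, hlim⟩ := hg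
  have : Nonempty X := ⟨o⟩
  obtain ⟨E, hE⟩ := H.exists_eventually_dist_le hC o hα
  have key : ∀ n : ℕ, n * l ≤ E := by
    intro n
    rcases Nat.eq_zero_or_pos n with rfl | hn
    · obtain ⟨m, hm⟩ := (hE 1).exists
      simp only [one_smul, dist_self, equivariant_one H.smul, abs_zero, zero_add] at hm
      simpa using hm
    have hn' : (0 : ℝ) < n := by exact_mod_cast hn
    obtain ⟨m, hm⟩ := (hE (g ^ n)).exists
    rw [equivariant_pow H.smul, h0, mul_zero, abs_zero, zero_add] at hm
    set x := α ^ m • o with hx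
    have hk : ∀ k : ℕ, dist x ((g ^ n) ^ k • x) ≤ k * E := fun k => by
      induction k with
      | zero => simp
      | succ k ih =>
        have h2 := dist_triangle x ((g ^ n) ^ k • x) ((g ^ n) ^ (k + 1) • x)
        rw [pow_succ, mul_smul, dist_smul] at h2
        rw [pow_succ, mul_smul]
        push_cast
        linarith
    have hk' : ∀ k : ℕ, dist o (g ^ (n * k) • o) ≤ k * E + 2 * dist o x := fun k => by
      have h1 := dist_triangle4 o x ((g ^ n) ^ k • x) ((g ^ n) ^ k • o)
      rw [dist_smul, dist_comm x o] at h1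
      rw [pow_mul]
      linarith [hk k]
    have ht : Tendsto (fun k : ℕ => n * (dist o (g ^ (n * k) • o) / ((n * k : ℕ) : ℝ))) atTop
        (𝓝 (n * l)) :=
      (hlim.comp (tendsto_id.const_mul_atTop' hn)).const_mul _
    have ht' : Tendsto (fun k : ℕ => E + 2 * dist o x / k) atTop (𝓝 E) := by
      simpa using tendsto_const_nhds.add (tendsto_const_div_atTop_nhds_zero_nat (2 * dist o x))
    refine le_of_tendsto_of_tendsto ht ht' ?_
    filter_upwards [eventually_gt_atTop 0] with k hk0
    have hk0' : (0 : ℝ) < k := by exact_mod_cast hk0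
    have e : (n : ℝ) * (dist o (g ^ (n * k) • o) / ((n * k : ℕ) : ℝ)) =
        dist o (g ^ (n * k) • o) / k := by
      push_cast
      field_simp
    rw [e, div_le_iff₀ hk0', add_mul, div_mul_cancel₀ _ hk0'.ne']
    linarith [hk' k]
  obtain ⟨n, hn⟩ := exists_nat_gt (E / l)
  rw [div_lt_iff₀ hl] at hn
  linarith [key n]

end Rays

end IsEquivariantHorofunction

section Endpoints

variable {X : Type*} [MetricSpace X] [IsGromovHyperbolic X] {M : Type*} [Group M]
  [MulAction M X] [IsIsometricSMul M X]

theorem smul_eq_of_mem_endpoints {g : M} {η : Boundary X} (h : η ∈ endpoints X g) :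
    g • η = η := by
  obtain ⟨k, x, hk, hx⟩ := h
  refine hx.smul_eq (r := dist x (g • x)) fun n => ?_
  obtain ⟨i, hi⟩ := hk n
  have hi' : g ^ i = k n := hi
  rw [smul_smul, ← hi', ← zpow_one_add, add_comm, zpow_add, zpow_one, mul_smul, dist_smul]

end Endpoints

/-! ### Dynamics on the boundary: properness, transitivity, focality -/

namespace IsEquivariantHorofunction

variable {X : Type*} [MetricSpace X] [IsGromovHyperbolic X] {M : Type*} [Group M]
  [MulAction M X] {ξ : Boundary X} {B : X → ℝ} {κ : M → ℝ} {C : ℝ}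

theorem continuous [TopologicalSpace M] [ContinuousSMul M X]
    (H : IsEquivariantHorofunction ξ B κ C) (o : X) : Continuous κ := by
  have : κ = fun g => B (g • o) - B o := funext (H.apply_eq o)
  rw [this]
  exact ((continuous_of_sub_le_dist H.sub_le).comp
    (continuous_id.smul continuous_const)).sub continuous_const

variable [IsIsometricSMul M X]

/-- Displacement of a horospherical element `u` in terms of the positions relative to `ξ` of
two boundary points `η` and `u • η`. -/
theorem dist_smul_le_of_ker (H : IsEquivariantHorofunction ξ B κ C) {o : X} {η : Boundary X}
    {E : ℝ}
    {u : M} (hu : κ u = 0)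
    (h : ∀ y : ℕ → X, Represents y η → ∀ᶠ n in atTop, dist o (y n) ≤ B (y n) - B o + E)
    (h' : ∀ y : ℕ → X, Represents y (u • η) → ∀ᶠ n in atTop, dist o (y n) ≤ B (y n) - B o + E) :
    dist o (u • o) ≤ E + C := by
  obtain ⟨y, hy⟩ := η.exists_represents
  obtain ⟨n, h1, h2⟩ := ((h y hy).and (h' _ (hy.smul u))).exists
  rw [H.smul, hu] at h2
  have e : dist (y n) (u⁻¹ • o) = dist o (u • y n) := by
    rw [← dist_smul u, smul_inv_smul, dist_comm]
  have hB : B (u⁻¹ • o) = B o := by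
    have := H.smul u (u⁻¹ • o)
    rw [smul_inv_smul, hu] at this
    linarith
  -- Seen from `y n`, close to `η`, both `o` and `u⁻¹ • o` lie near rays to `ξ`, and at the same
  -- level.
  have h3 := H.dist_le_of_rays (y := y n) (y' := u⁻¹ • o) (z' := o) (E := E)
    (by rw [hB]; linarith) (by rw [dist_comm]; linarith)
  rw [hB, sub_self, abs_zero, zero_add, ← dist_smul u, smul_inv_smul] at h3
  exact h3

theorem exists_dist_le_of_fixed (H : IsEquivariantHorofunction ξ B κ C) (o : X) {η : Boundary X}
    (hη : η ≠ ξ) : ∃ R, ∀ u : M, κ u = 0 → u • η = η → dist o (u • o) ≤ R := by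
  obtain ⟨E, hE⟩ := H.horo.exists_forall_represents hη o
  exact ⟨E + C, fun u hu huη => H.dist_smul_le_of_ker hu hE (by rwa [huη])⟩

/-- The conjugate displaces `o` as much as `u` displaces `(α ^ n)⁻¹ • o`, and `α⁻¹` translates
towards `ξ`. -/
theorem exists_conj_dist_le (H : IsEquivariantHorofunction ξ B κ C) (hC : 0 ≤ C) (o : X) {α : M}
    (hα : 0 < κ α) : ∃ R, ∀ u : M, κ u = 0 →
      ∃ n₀ : ℕ, ∀ n > n₀, dist o ((α ^ n * u * (α ^ n)⁻¹) • o) ≤ R := by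
  have : Nonempty X := ⟨o⟩
  obtain ⟨E, hE⟩ := H.exists_eventually_dist_le hC o (α := α⁻¹)
    (by rw [equivariant_inv H.smul]; linarith)
  refine ⟨E, fun u hu => ?_⟩
  obtain ⟨N, hN⟩ := eventually_atTop.1 (hE u)
  refine ⟨N, fun n hn => ?_⟩
  have h1 := hN n hn.le
  rw [hu, abs_zero, zero_add, ← dist_conj] at h1
  simpa using h1

theorem exists_dist_le_of_isClosed (H : IsEquivariantHorofunction ξ B κ C) (o : X)
    {K : Set (Boundary X)} (hK : IsClosed K) (hξ : ξ ∉ K) :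
    ∃ R, ∀ u : M, κ u = 0 → (∃ η ∈ K, u • η ∈ K) → dist o (u • o) ≤ R := by
  obtain ⟨E, hE⟩ := H.horo.exists_forall_mem hK hξ o
  refine ⟨E + C, fun u hu ⟨η, hη, hη'⟩ => H.dist_smul_le_of_ker hu (hE η hη) (hE _ hη')⟩

/-- Every element is congruent modulo the kernel to one of bounded displacement. -/
theorem exists_apply_eq_dist_le (H : IsEquivariantHorofunction ξ B κ C) (hC : 0 ≤ C)
    (hgeod : IsGeodesic X) (hcob : IsCobounded M X) (o : X) :
    ∃ E, ∀ g : M, ∃ k : M, κ k = κ g ∧ dist o (k • o) ≤ |κ g| + E := by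
  have : Nonempty X := ⟨o⟩
  obtain ⟨α, hα⟩ := H.exists_apply_neg hgeod hcob o
  obtain ⟨E, hE⟩ := H.exists_eventually_dist_le hC o hα
  refine ⟨E, fun g => ?_⟩
  obtain ⟨n, hn⟩ := (hE g).exists
  refine ⟨(α ^ n)⁻¹ * g * α ^ n, ?_, by rwa [dist_conj]⟩
  rw [equivariant_mul H.smul, equivariant_mul H.smul, equivariant_inv H.smul]
  ring

variable [TopologicalSpace M] [ContinuousSMul M X]

/-- The group is transitive on the complement of `ξ`, from the repelling point of `α`. -/
theorem exists_smul_eq (H : IsEquivariantHorofunction ξ B κ C) (hC : 0 ≤ C)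
    (hproper : IsMetricallyProper M X) (hcob : IsCobounded M X) (o : X) {α : M} (hα : κ α < 0)
    {η₀ η : Boundary X} (hη₀ : Represents (fun n : ℕ => (α ^ n)⁻¹ • o) η₀) (hη : η ≠ ξ) :
    ∃ g : M, g • η₀ = η := by
  have : Nonempty X := ⟨o⟩
  obtain ⟨δ, hδ⟩ := exists_hypConst X
  obtain ⟨E, hE⟩ := H.exists_iterate_le hC o hα
  obtain ⟨y₀, hy₀⟩ := η.exists_represents
  obtain ⟨r, hr⟩ := hcob.exists_radius o
  choose g hg using fun n => hr (y₀ n)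
  have hy : Represents (fun n => g n • o) η := hy₀.of_dist_le hg
  obtain ⟨E', hE'⟩ := H.horo.exists_forall_represents hη o
  have hev := hE' _ hy
  set c := -κ α with hc
  have hc0 : 0 < c := by linarith
  -- Along the ray `g n • α ^ i • o` towards `ξ`, `k n` steps return to the level of `o` up to less
  -- than one step `c`. There the ray passes at bounded distance from `o`, so properness gives a
  -- limit `h` of `g n * α ^ k n`.
  set k : ℕ → ℕ := fun n => ⌊κ (g n) / c⌋₊ with hk
  have hκ : Tendsto (fun n => κ (g n)) atTop atTop := by
    refine tendsto_atTop_mono' _ ?_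
      (tendsto_atTop_add_const_right _ (-E') (hy.cauchy.tendsto_dist o))
    filter_upwards [hev] with n hn
    rw [H.smul] at hn
    linarith
  have hkt : Tendsto k atTop atTop :=
    tendsto_nat_floor_atTop.comp (hκ.atTop_div_const hc0)
  have hshift : ∀ n j : ℕ, κ (g n * α ^ k n * (α ^ j)⁻¹) = κ (g n) - k n * c + j * c :=
    fun n j => by
      rw [equivariant_mul H.smul, equivariant_mul H.smul, equivariant_inv H.smul,
        equivariant_pow H.smul, equivariant_pow H.smul, hc]
      ring
  have hray : ∀ n j : ℕ, j ≤ k n → dist (g n • o) ((g n * α ^ k n * (α ^ j)⁻¹) • o) ≤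
      κ (g n) - κ (g n * α ^ k n * (α ^ j)⁻¹) + E := fun n j hj => by
    rw [hshift]
    obtain ⟨i, hi⟩ := Nat.exists_eq_add_of_le' hj
    rw [hi, pow_add, mul_assoc, mul_inv_cancel_right, mul_smul, dist_smul]
    push_cast
    linarith [hE i]
  have hbd : ∀ᶠ n in atTop, g n * α ^ k n ∈
      {h : M | dist o (h • o) ≤ c + (max E E' + C)} := by
    filter_upwards [hev, hκ.eventually_ge_atTop 0] with n h1 h2
    have h3 := hray n 0 (Nat.zero_le _)
    have h4 := hshift n 0
    rw [pow_zero, inv_one, mul_one] at h3 h4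
    have h5 : (k n : ℝ) * c ≤ κ (g n) := by
      rw [← le_div_iff₀ hc0]
      exact Nat.floor_le (div_nonneg h2 hc0.le)
    have h6 : κ (g n) < (k n + 1) * c := by
      rw [← div_lt_iff₀ hc0]
      exact Nat.lt_floor_add_one _
    have h7 := H.dist_le_of_rays (y := g n • o) (y' := o) (z' := (g n * α ^ k n) • o)
      (E := max E E') (by rw [dist_comm]; linarith [le_max_right E E'])
      (by rw [H.smul, H.smul]; linarith [le_max_left E E'])
    rw [H.smul, sub_add_cancel_left, abs_neg, h4, abs_of_nonneg (by simp; linarith)] at h7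
    simp only [Nat.cast_zero, zero_mul, add_zero] at h7
    show dist o ((g n * α ^ k n) • o) ≤ _
    linarith
  obtain ⟨h, -, hh⟩ := (hproper.isCompact_setOf_dist_le o _).exists_mapClusterPt
    (le_principal_iff.2 hbd)
  refine ⟨h, (hη₀.smul h).eq hy ((asymptotic_iff o).2 (tendsto_atTop.2 fun R => ?_))⟩
  obtain ⟨N, hN⟩ := (isCauchyGromov_iff o).1 hy.cauchy (R + δ)
  have hjt : Tendsto (fun j : ℕ => (j : ℝ) * c) atTop atTop := tendsto_natCast_mul_neg hα
  filter_upwards [tendsto_atTop.1 hjt (R + δ + E / 2 + 1 - κ h), eventually_ge_atTop N]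
    with j hj hjN
  -- With `j` fixed, a suitable later `n` puts `h • (α ^ j)⁻¹ • o` within 1 of the ray from `g n •
  -- o`, so its product with `g n • o` is large; the Cauchy property then replaces `g n` by `g j`.
  have hnear : {s : M | dist ((s * (α ^ j)⁻¹) • o) ((h * (α ^ j)⁻¹) • o) < 1} ∈ 𝓝 h := by
    refine IsOpen.mem_nhds (isOpen_lt ?_ continuous_const) (by simp)
    simp only [mul_smul]
    exact (continuous_id.smul continuous_const).dist continuous_const
  obtain ⟨n, hn1, hn2, hn3⟩ := ((mapClusterPt_iff_frequently.1 hh _ hnear).and_eventually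
    ((hkt.eventually_ge_atTop j).and (eventually_ge_atTop N))).exists
  have hn1' : dist ((g n * α ^ k n * (α ^ j)⁻¹) • o) ((h * (α ^ j)⁻¹) • o) < 1 := hn1
  set q := (h * (α ^ j)⁻¹) • o with hq
  have hBq : B q = B o + κ h + j * c := by
    rw [hq, H.smul, equivariant_mul H.smul, equivariant_inv H.smul, equivariant_pow H.smul, hc]
    ring
  have h1 := hray n j hn2
  have h2 := dist_triangle (g n • o) ((g n * α ^ k n * (α ^ j)⁻¹) • o) q
  have h3 := H.sub_le q ((g n * α ^ k n * (α ^ j)⁻¹) • o)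
  rw [dist_comm q] at h3
  have hBn := H.smul (g n * α ^ k n * (α ^ j)⁻¹) o
  have h4 : R + δ ≤ gromovProduct o q (g n • o) := by
    have h5 := H.sub_le q o
    have h6 := H.sub_le (g n • o) o
    rw [H.smul] at h6
    unfold gromovProduct
    rw [dist_comm q o] at h5
    rw [dist_comm (g n • o) o] at h6
    rw [dist_comm q]
    linarith
  have h7 := hδ.min_le o q (g j • o) (g n • o) h4 (hN n hn3 j hjN)
  rw [hq, mul_smul] at h7
  linarith

/-- The stabilizer of the repelling point of `α` surjects onto the image of the character. -/
theorem exists_fixing (H : IsEquivariantHorofunction ξ B κ C) (hC : 0 ≤ C)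
    (hproper : IsMetricallyProper M X) (o : X) {α : M} (hα : κ α < 0)
    {η₀ : Boundary X} (hη₀ : Represents (fun n : ℕ => (α ^ n)⁻¹ • o) η₀) (g : M) :
    ∃ s : M, κ s = κ g ∧ s • η₀ = η₀ := by
  have : Nonempty X := ⟨o⟩
  obtain ⟨E, hE⟩ := H.exists_eventually_dist_le hC o hα
  have hg := hE g
  obtain ⟨s, -, hs⟩ := (hproper.isCompact_setOf_dist_le o (|κ g| + E)).exists_mapClusterPt
    (f := atTop) (u := fun n : ℕ => (α ^ n)⁻¹ * g * α ^ n) (by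
      rw [le_principal_iff, mem_map]
      filter_upwards [hg] with n hn
      show dist o _ ≤ _
      rwa [dist_conj])
  refine ⟨s, mem_of_mapClusterPt hs (isClosed_singleton.preimage (H.continuous o))
    (Eventually.of_forall fun n => ?_), hη₀.smul_eq (r := |κ g| + E) fun j => ?_⟩
  · show κ _ = κ g
    rw [equivariant_mul H.smul, equivariant_mul H.smul, equivariant_inv H.smul]
    ring
  -- The conjugate by `α ^ n` displaces `(α ^ j)⁻¹ • o` as much as `g` displaces `α ^ (n - j) • o`.
  -- That bound is uniform in `j` and closed, so the limit `s` moves the whole backward orbit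
  -- boundedly.
  · refine mem_of_mapClusterPt (s := {s : M | dist ((α ^ j)⁻¹ • o) (s • (α ^ j)⁻¹ • o) ≤
      |κ g| + E}) hs ?_ ?_
    · exact isClosed_le (continuous_const.dist (continuous_id.smul continuous_const))
        continuous_const
    · filter_upwards [(tendsto_sub_atTop_nat j).eventually hg, eventually_ge_atTop j] with n hn hj
      obtain ⟨i, rfl⟩ := Nat.exists_eq_add_of_le' hj
      rw [Nat.add_sub_cancel] at hn
      show dist _ _ ≤ _
      have e : ((α ^ (i + j))⁻¹ * g * α ^ (i + j)) • (α ^ j)⁻¹ • o =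
          (α ^ (i + j))⁻¹ • g • α ^ i • o := by
        simp only [← mul_smul]
        congr 1
        rw [pow_add]
        group
      rw [e, ← dist_smul (α ^ (i + j)), smul_inv_smul, ← mul_smul (α ^ (i + j)), pow_add,
        mul_inv_cancel_right]
      exact hn

theorem exists_ker_smul_eq (H : IsEquivariantHorofunction ξ B κ C) (hC : 0 ≤ C)
    (hproper : IsMetricallyProper M X) (hcob : IsCobounded M X) (o : X) {α : M} (hα : κ α < 0)
    {η₀ η : Boundary X} (hη₀ : Represents (fun n : ℕ => (α ^ n)⁻¹ • o) η₀) (hη : η ≠ ξ) :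
    ∃ u : M, κ u = 0 ∧ u • η₀ = η := by
  have : Nonempty X := ⟨o⟩
  obtain ⟨g, hg⟩ := H.exists_smul_eq hC hproper hcob o hα hη₀ hη
  obtain ⟨s, hs, hs'⟩ := H.exists_fixing hC hproper o hα hη₀ g
  refine ⟨g * s⁻¹, ?_, ?_⟩
  · rw [equivariant_mul H.smul, equivariant_inv H.smul, hs]
    ring
  · rw [mul_smul, inv_smul_eq_iff.2 hs'.symm, hg]

/-- The kernel of the character is transitive on the complement of `ξ`. -/
theorem ker_transitive (H : IsEquivariantHorofunction ξ B κ C) (hC : 0 ≤ C)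
    (hgeod : IsGeodesic X) (hproper : IsMetricallyProper M X) (hcob : IsCobounded M X) (o : X)
    {η ζ : Boundary X} (hη : η ≠ ξ) (hζ : ζ ≠ ξ) : ∃ u : M, κ u = 0 ∧ u • η = ζ := by
  have : Nonempty X := ⟨o⟩
  obtain ⟨α, hα⟩ := H.exists_apply_neg hgeod hcob o
  obtain ⟨η₀, h0⟩ : ∃ η₀ : Boundary X, Represents (fun n : ℕ => (α ^ n)⁻¹ • o) η₀ :=
    ⟨_, represents_mk (H.isCauchyGromov_inv_iterate hC o hα)⟩
  obtain ⟨u, hu, rfl⟩ := H.exists_ker_smul_eq hC hproper hcob o hα h0 hη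
  obtain ⟨v, hv, rfl⟩ := H.exists_ker_smul_eq hC hproper hcob o hα h0 hζ
  refine ⟨v * u⁻¹, ?_, ?_⟩
  · rw [equivariant_mul H.smul, equivariant_inv H.smul, hu, hv]
    ring
  · rw [mul_smul, inv_smul_smul]

/-- Lineality is excluded by conjugating `α` with a kernel element `u` that moves `η₀` to a third
point `ζ`: equal endpoints make `α` fix `ζ` too. The commutators of `u⁻¹` and `α ^ k` then lie in
the kernel and fix `η₀`, so they have bounded displacement. Hence `u` moves the backward orbit of
`α` boundedly and fixes `η₀`, so `ζ = η₀`. -/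
theorem isFocal (H : IsEquivariantHorofunction ξ B κ C) (hC : 0 ≤ C)
    (hgeod : IsGeodesic X) (hX : IsNonElementary X) (hξ : ∀ g : M, g • ξ = ξ)
    (hproper : IsMetricallyProper M X) (hcob : IsCobounded M X) (o : X) : IsFocal M X := by
  have : Nonempty X := ⟨o⟩
  obtain ⟨α, hα⟩ := H.exists_apply_neg hgeod hcob o
  refine ⟨⟨α, H.isHyperbolicElement hC o hα⟩, fun hlin => ?_, fun g k hg hk =>
    ⟨ξ, H.mem_endpoints o (H.apply_ne_zero hC hα hg), H.mem_endpoints o (H.apply_ne_zero hC hα hk)⟩⟩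
  obtain ⟨η₀, h0⟩ : ∃ η₀ : Boundary X, Represents (fun n : ℕ => (α ^ n)⁻¹ • o) η₀ :=
    ⟨_, represents_mk (H.isCauchyGromov_inv_iterate hC o hα)⟩
  obtain ⟨ζ, hζ, hζ0⟩ : ∃ ζ : Boundary X, ζ ≠ ξ ∧ ζ ≠ η₀ := by
    obtain ⟨a, b, c, hab, hac, hbc⟩ := hX
    by_contra! hcon
    by_cases ha : a = ξ
    · exact hbc ((hcon b (ha ▸ hab.symm)).trans (hcon c (ha ▸ hac.symm)).symm)
    · have ha0 := hcon a ha
      have hb : b = ξ := by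
        by_contra hb
        exact hab (ha0.trans (hcon b hb).symm)
      have hc : c = ξ := by
        by_contra hc
        exact hac (ha0.trans (hcon c hc).symm)
      exact hbc (hb.trans hc.symm)
  obtain ⟨u, hu, huζ⟩ := H.exists_ker_smul_eq hC hproper hcob o hα h0 hζ
  have hη₀ : η₀ ≠ ξ := by
    rintro rfl
    exact hζ (huζ.symm.trans (hξ u))
  have hαη : α • η₀ = η₀ := smul_eq_of_mem_endpoints
    ⟨fun n => (α ^ n)⁻¹, o, fun n => inv_mem (Subgroup.npow_mem_zpowers α n), h0⟩
  have hαζ : α • ζ = ζ := by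
    refine smul_eq_of_mem_endpoints (g := α) ?_
    rw [hlin.2 α (u * α * u⁻¹) (H.isHyperbolicElement hC o hα) (H.isHyperbolicElement hC o (by
      rwa [equivariant_mul H.smul, equivariant_mul H.smul, equivariant_inv H.smul, hu, zero_add,
        neg_zero, add_zero]))]
    refine ⟨fun n => ((u * α * u⁻¹) ^ n)⁻¹, u • o,
      fun n => inv_mem (Subgroup.npow_mem_zpowers _ n), ?_⟩
    have h1 := h0.smul u
    rw [huζ] at h1
    convert h1 using 2 with n
    show ((u * α * u⁻¹) ^ n)⁻¹ • u • o = u • (α ^ n)⁻¹ • o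
    rw [conj_pow, mul_inv_rev, mul_inv_rev, inv_inv, ← mul_assoc, mul_smul, mul_smul,
      inv_smul_smul]
  obtain ⟨R, hR⟩ := H.exists_dist_le_of_fixed o hη₀ (M := M)
  have hpow : ∀ (k : ℕ) {η : Boundary X}, α • η = η → α ^ k • η = η := fun k η h => by
    induction k with
    | zero => simp
    | succ k ih => rw [pow_succ, mul_smul, h, ih]
  refine hζ0 (huζ.symm.trans (h0.smul_eq (r := dist o (u • o) + R) fun k => ?_))
  have h1 := hR (u⁻¹ * (α ^ k * u * (α ^ k)⁻¹)) (by
      simp only [equivariant_mul H.smul, equivariant_inv H.smul, hu]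
      ring) (by
      rw [mul_smul, mul_smul, mul_smul, inv_smul_eq_iff.2 (hpow k hαη).symm, huζ, hpow k hαζ,
        ← huζ, inv_smul_smul])
  have h2 := dist_triangle o (u • o) ((α ^ k * u * (α ^ k)⁻¹) • o)
  have h3 : dist (u • o) ((α ^ k * u * (α ^ k)⁻¹) • o) =
      dist o ((u⁻¹ * (α ^ k * u * (α ^ k)⁻¹)) • o) := by
    rw [← dist_smul u o, mul_smul u⁻¹, smul_inv_smul]
  have h4 : dist ((α ^ k)⁻¹ • o) (u • (α ^ k)⁻¹ • o) = dist o ((α ^ k * u * (α ^ k)⁻¹) • o) := by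
    rw [← dist_smul (α ^ k), smul_inv_smul, mul_smul, mul_smul]
  linarith

theorem fixed_iff (H : IsEquivariantHorofunction ξ B κ C) (hC : 0 ≤ C)
    (hgeod : IsGeodesic X) (hX : IsNonElementary X) (hξ : ∀ g : M, g • ξ = ξ)
    (hproper : IsMetricallyProper M X) (hcob : IsCobounded M X) (o : X) (ζ : Boundary X) :
    (∀ g : M, g • ζ = ζ) ↔ ζ = ξ := by
  refine ⟨fun h => ?_, fun h => h ▸ hξ⟩
  by_contra hne
  have huniq : ∀ ω : Boundary X, ω ≠ ξ → ω = ζ := fun ω hω => by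
    obtain ⟨u, -, hu⟩ := H.ker_transitive hC hgeod hproper hcob o hne hω
    rw [← hu, h]
  obtain ⟨a, b, c, hab, hac, hbc⟩ := hX
  by_cases ha : a = ξ
  · exact hbc ((huniq b (ha ▸ hab.symm)).trans (huniq c (ha ▸ hac.symm)).symm)
  · by_cases hb : b = ξ
    · exact hac ((huniq a ha).trans (huniq c (hb ▸ hbc.symm)).symm)
    · exact hab ((huniq a ha).trans (huniq b hb).symm)

/-- Near any `t`, all values of `κ` are attained on a single compact set of elements of bounded
displacement. -/
theorem isClosed_range (H : IsEquivariantHorofunction ξ B κ C) (hC : 0 ≤ C)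
    (hgeod : IsGeodesic X) (hproper : IsMetricallyProper M X) (hcob : IsCobounded M X) (o : X) :
    IsClosed (Set.range κ) := by
  obtain ⟨E, hE⟩ := H.exists_apply_eq_dist_le hC hgeod hcob o
  refine isClosed_of_closure_subset fun t ht => ?_
  have hK := ((hproper.isCompact_setOf_dist_le o (|t| + 1 + E)).image (H.continuous o)).isClosed
  have hsub : t ∈ closure (κ '' {g : M | dist o (g • o) ≤ |t| + 1 + E}) := by
    rw [Metric.mem_closure_iff] at ht ⊢
    intro ε hε
    obtain ⟨_, ⟨g, rfl⟩, hg⟩ := ht (min ε 1) (lt_min hε one_pos)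
    obtain ⟨k, hk, hk'⟩ := hE g
    refine ⟨κ k, ⟨k, ?_, rfl⟩, by rw [hk]; exact hg.trans_le (min_le_left _ _)⟩
    have h1 : |t - κ g| ≤ 1 := by
      rw [← Real.dist_eq]
      exact hg.le.trans (min_le_right _ _)
    have h2 := abs_sub_abs_le_abs_sub (κ g) t
    rw [abs_sub_comm] at h2
    show dist o (k • o) ≤ _
    linarith
  rw [hK.closure_eq] at hsub
  exact Set.image_subset_range _ _ hsub

end IsEquivariantHorofunction

/-! ### Subgroups generated by the kernel of a real character and one element -/

section RealCharacters

variable {M : Type*} [Group M] (β : M →* Multiplicative ℝ) {α : M}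

/-- The subgroup is the preimage of the cyclic group generated by `β α`, so its properties can be
read off in `ℝ`. -/
theorem mem_closure_ker_union_iff (g : M) :
    g ∈ Subgroup.closure ((β.ker : Set M) ∪ {α}) ↔ ∃ k : ℤ, β g = β (α ^ k) := by
  constructor
  · intro hg
    induction hg using Subgroup.closure_induction with
    | mem x hx =>
      rcases hx with hx | rfl
      · exact ⟨0, by rw [zpow_zero, map_one]; exact hx⟩
      · exact ⟨1, by rw [zpow_one]⟩
    | one => exact ⟨0, by rw [zpow_zero]⟩
    | mul x y _ _ hx hy =>
      obtain ⟨i, hi⟩ := hx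
      obtain ⟨j, hj⟩ := hy
      exact ⟨i + j, by rw [map_mul, hi, hj, zpow_add, map_mul]⟩
    | inv x _ hx =>
      obtain ⟨i, hi⟩ := hx
      exact ⟨-i, by rw [map_inv, hi, zpow_neg, map_inv]⟩
  · rintro ⟨k, hk⟩
    have h1 : g * (α ^ k)⁻¹ ∈ β.ker := by
      rw [MonoidHom.mem_ker, map_mul, map_inv, hk, mul_inv_cancel]
    have hsub := Subgroup.subset_closure (k := (β.ker : Set M) ∪ {α})
    have h2 := mul_mem (hsub (Or.inl h1)) (zpow_mem (hsub (Or.inr rfl)) k)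
    rwa [inv_mul_cancel_right] at h2

theorem normal_closure_ker_union : (Subgroup.closure ((β.ker : Set M) ∪ {α})).Normal := by
  refine ⟨fun g hg h => ?_⟩
  rw [mem_closure_ker_union_iff] at hg ⊢
  obtain ⟨k, hk⟩ := hg
  exact ⟨k, by rw [map_mul, map_mul, map_inv, mul_inv_cancel_comm, hk]⟩

theorem toAdd_map_zpow (k : ℤ) : (β (α ^ k)).toAdd = k * (β α).toAdd := by
  rw [map_zpow, toAdd_zpow, zsmul_eq_mul]

theorem toAdd_ne_zero (hα : α ∉ β.ker) : (β α).toAdd ≠ 0 := fun h =>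
  hα (MonoidHom.mem_ker.2 (Multiplicative.toAdd.injective h))

theorem isClosed_closure_ker_union [TopologicalSpace M]
    (hβ : Continuous fun g : M => (β g).toAdd) (hα : α ∉ β.ker) :
    IsClosed (Subgroup.closure ((β.ker : Set M) ∪ {α}) : Set M) := by
  have h0 := toAdd_ne_zero β hα
  have h1 := Int.isClosedEmbedding_coe_real.isClosed_range.preimage
    (hβ.div_const (β α).toAdd)
  convert h1 using 1
  ext g
  rw [SetLike.mem_coe, mem_closure_ker_union_iff, Set.mem_preimage, Set.mem_range]
  refine exists_congr fun k => ?_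
  rw [eq_div_iff h0, ← toAdd_map_zpow, eq_comm]
  exact Multiplicative.toAdd.injective.eq_iff.symm

theorem compactSpace_quotient_closure_ker_union [TopologicalSpace M] (hα : α ∉ β.ker)
    {K : Set M} (hK : IsCompact K)
    (h : ∀ g : M, |(β g).toAdd| ≤ |(β α).toAdd| → ∃ k ∈ K, β k = β g) :
    CompactSpace (M ⧸ Subgroup.closure ((β.ker : Set M) ∪ {α})) := by
  have h0 := toAdd_ne_zero β hα
  refine ⟨?_⟩
  convert hK.image (QuotientGroup.continuous_mk
    (N := Subgroup.closure ((β.ker : Set M) ∪ {α}))) using 1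
  symm
  refine Set.eq_univ_of_forall fun x => ?_
  obtain ⟨g, rfl⟩ := QuotientGroup.mk_surjective x
  -- Removing `⌊r⌋` powers of `α` brings the value of `β` into the range covered by `K`.
  set r := (β g).toAdd / (β α).toAdd with hr
  have h1 : (β (g * α ^ (-⌊r⌋))).toAdd = Int.fract r * (β α).toAdd := by
    rw [map_mul, toAdd_mul, toAdd_map_zpow, Int.fract, sub_mul, hr, div_mul_cancel₀ _ h0]
    push_cast
    ring
  obtain ⟨k, hk, hk'⟩ := h (g * α ^ (-⌊r⌋)) (by
    rw [h1, abs_mul, Int.abs_fract]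
    exact mul_le_of_le_one_left (abs_nonneg _) (Int.fract_lt_one r).le)
  refine ⟨k, hk, QuotientGroup.eq.2 ((mem_closure_ker_union_iff β _).2 ⟨⌊r⌋, ?_⟩)⟩
  rw [map_mul, map_inv, hk', map_mul, zpow_neg, map_inv, mul_inv, inv_inv, mul_right_comm,
    inv_mul_cancel, one_mul]

theorem ker_mul_zpowers_injective (hα : α ∉ β.ker) {u v : M} (hu : u ∈ β.ker) (hv : v ∈ β.ker)
    {i j : ℤ} (h : u * α ^ i = v * α ^ j) : u = v ∧ i = j := by
  have h1 : (β (α ^ i)).toAdd = (β (α ^ j)).toAdd := by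
    have h2 := congrArg β h
    rw [map_mul, map_mul, MonoidHom.mem_ker.1 hu, MonoidHom.mem_ker.1 hv, one_mul, one_mul] at h2
    rw [h2]
  rw [toAdd_map_zpow, toAdd_map_zpow] at h1
  have hij : i = j := by exact_mod_cast mul_right_cancel₀ (toAdd_ne_zero β hα) h1
  subst hij
  exact ⟨mul_right_cancel h, rfl⟩

theorem injective_ker_mul_zpowers (hα : α ∉ β.ker) :
    Function.Injective fun p : β.ker × Subgroup.zpowers α => (p.1 : M) * (p.2 : M) := by
  rintro ⟨⟨u, hu⟩, ⟨_, i, rfl⟩⟩ ⟨⟨v, hv⟩, ⟨_, j, rfl⟩⟩ h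
  obtain ⟨rfl, rfl⟩ := ker_mul_zpowers_injective β hα hu hv h
  rfl

theorem exists_semidirect_mulEquiv (hα : α ∉ β.ker) :
    ∃ e : β.ker ⋊[conjCyclic β.ker α] Subgroup.zpowers α ≃*
        Subgroup.closure ((β.ker : Set M) ∪ {α}),
      ∀ p, (e p : M) = (p.left : M) * (p.right : M) := by
  let f : β.ker ⋊[conjCyclic β.ker α] Subgroup.zpowers α →* M :=
    SemidirectProduct.lift β.ker.subtype (Subgroup.zpowers α).subtype fun a => by
      ext u
      simp [conjCyclic]
  have hf : ∀ p, f p = (p.left : M) * (p.right : M) := fun p => rfl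
  have hmem : ∀ p, f p ∈ Subgroup.closure ((β.ker : Set M) ∪ {α}) := by
    rintro ⟨⟨u, hu⟩, ⟨_, i, rfl⟩⟩
    refine (mem_closure_ker_union_iff β _).2 ⟨i, ?_⟩
    rw [hf, map_mul]
    show β u * β (α ^ i) = _
    rw [MonoidHom.mem_ker.1 hu, one_mul]
  refine ⟨MulEquiv.ofBijective (f.codRestrict _ hmem) ⟨fun p q h => ?_, fun ⟨g, hg⟩ => ?_⟩,
    fun p => hf p⟩
  · have h1 : f p = f q := congrArg Subtype.val h
    have h2 := injective_ker_mul_zpowers β hα (a₁ := (p.left, p.right)) (a₂ := (q.left, q.right)) h1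
    exact SemidirectProduct.ext (congrArg Prod.fst h2) (congrArg Prod.snd h2)
  · obtain ⟨k, hk⟩ := (mem_closure_ker_union_iff β g).1 hg
    have h1 : g * (α ^ k)⁻¹ ∈ β.ker := by
      rw [MonoidHom.mem_ker, map_mul, map_inv, hk, mul_inv_cancel]
    refine ⟨⟨⟨_, h1⟩, ⟨α ^ k, k, rfl⟩⟩, Subtype.ext ?_⟩
    show g * (α ^ k)⁻¹ * α ^ k = g
    rw [inv_mul_cancel_right]

/-- On products `u * α ^ i` the value of `β` is a multiple of `β α`, hence discrete. The cyclic
factor is therefore locally constant in the product, and dividing by it recovers the kernel factor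
continuously. -/
theorem isEmbedding_ker_mul_zpowers [TopologicalSpace M] [IsTopologicalGroup M]
    (hβ : Continuous fun g : M => (β g).toAdd) (hα : α ∉ β.ker) :
    IsEmbedding fun p : β.ker × Subgroup.zpowers α => (p.1 : M) * (p.2 : M) := by
  have h0 := toAdd_ne_zero β hα
  refine ⟨isInducing_iff_nhds.2 fun p => le_antisymm ?_ ?_, injective_ker_mul_zpowers β hα⟩
  · have hc : Continuous fun p : β.ker × Subgroup.zpowers α => (p.1 : M) * (p.2 : M) := by
      fun_prop
    exact (hc.tendsto p).le_comap
  · set l := comap (fun p : β.ker × Subgroup.zpowers α => (p.1 : M) * (p.2 : M))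
      (𝓝 ((p.1 : M) * (p.2 : M))) with hl
    have hlim : Tendsto (fun p : β.ker × Subgroup.zpowers α => (p.1 : M) * (p.2 : M)) l
      (𝓝 ((p.1 : M) * (p.2 : M))) := tendsto_comap
    have hval : ∀ q : β.ker × Subgroup.zpowers α, β ((q.1 : M) * (q.2 : M)) = β (q.2 : M) :=
      fun q => by rw [map_mul, MonoidHom.mem_ker.1 q.1.2, one_mul]
    have hsnd : ∀ᶠ q in l, q.2 = p.2 := by
      have h1 := ((hβ.tendsto _).comp hlim).eventually (Metric.ball_mem_nhds _ (abs_pos.2 h0))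
      filter_upwards [h1] with q hq
      obtain ⟨i, hi⟩ := q.2.2
      obtain ⟨j, hj⟩ := p.2.2
      have hi' : α ^ i = (q.2 : M) := hi
      have hj' : α ^ j = (p.2 : M) := hj
      rw [Function.comp_apply, hval, hval, ← hi', ← hj', toAdd_map_zpow,
        toAdd_map_zpow, Real.dist_eq, ← sub_mul, abs_mul] at hq
      have h2 : |(i : ℝ) - j| < 1 := by
        by_contra! hc
        exact absurd hq (not_lt.2 (le_mul_of_one_le_left (abs_nonneg _) hc))
      have h3 : |i - j| < 1 := by exact_mod_cast h2
      have h4 : i = j := sub_eq_zero.1 (Int.abs_lt_one_iff.1 h3)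
      exact Subtype.ext (by rw [← hi', ← hj', h4])
    have hfst : Tendsto Prod.fst l (𝓝 p.1) := by
      refine tendsto_subtype_rng.2 ?_
      have h1 := hlim.mul_const ((p.2 : M)⁻¹)
      rw [mul_inv_cancel_right] at h1
      refine h1.congr' ?_
      filter_upwards [hsnd] with q hq
      rw [hq, mul_inv_cancel_right]
    have hsnd' : Tendsto Prod.snd l (𝓝 p.2) :=
      tendsto_const_nhds.congr' (hsnd.mono fun q hq => hq.symm)
    rw [nhds_prod_eq]
    exact tendsto_id'.1 (hfst.prodMk hsnd')

end RealCharacters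

theorem isCompacting_conjNormal {M : Type*} [Group M] [TopologicalSpace M] [IsTopologicalGroup M]
    {U : Subgroup M} [U.Normal] (hU : IsClosed (U : Set M)) {α : M} {V : Set M}
    (hV : IsCompact V) (h : ∀ u ∈ U, ∃ n₀ : ℕ, ∀ n > n₀, α ^ n * u * (α ^ n)⁻¹ ∈ V) :
    IsCompacting (MulAut.conjNormal α : MulAut U) := by
  have hc : ∀ a : M, Continuous (MulAut.conjNormal a : MulAut U) := fun a => by
    refine continuous_induced_rng.2 ?_
    have : (Subtype.val ∘ (MulAut.conjNormal a : MulAut U) : U → M) =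
        fun u : U => a * u * a⁻¹ := by
      ext u
      simp
    rw [this]
    fun_prop
  refine ⟨hc α, ?_, Subtype.val ⁻¹' V, hU.isClosedEmbedding_subtypeVal.isCompact_preimage hV,
    fun u => ?_⟩
  · have := hc α⁻¹
    rwa [map_inv] at this
  · obtain ⟨n₀, hn₀⟩ := h u u.2
    refine ⟨n₀, fun n hn => ?_⟩
    rw [← map_pow, Set.mem_preimage, MulAut.conjNormal_apply]
    exact hn₀ n hn

/-! ### The quasicharacter, the proper action, and the final assembly -/

namespace IsEquivariantHorofunction

variable {X : Type*} [MetricSpace X] [IsGromovHyperbolic X] {M : Type*} [Group M]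
  [MulAction M X] {ξ : Boundary X} {B : X → ℝ} {κ : M → ℝ} {C : ℝ}

/-- Every horokernel at `ξ` is within a constant of `B p - B q`, and `B x - B (g ^ n • x)` is
exactly `-n * κ g`; division by `n` removes the constant. -/
theorem isBusemannQuasicharacter [IsIsometricSMul M X]
    (H : IsEquivariantHorofunction ξ B κ C) :
    IsBusemannQuasicharacter ξ fun g : M => -κ g := by
  refine ⟨ξ.exists_horokernel, fun h hh x g _ => ?_⟩
  have : Nonempty X := ⟨x⟩
  obtain ⟨δ, hδ⟩ := exists_hypConst X
  obtain ⟨y, hy⟩ := ξ.exists_represents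
  have key : ∀ p q, |h (p, q) - (B p - B q)| ≤ 2 * δ + 1 + C := fun p q => by
    obtain ⟨n, h1, h2⟩ := ((hh.close hδ one_pos hy p q).and (H.horo y hy p q)).exists
    rw [abs_le] at *
    constructor <;> linarith [h1.1, h1.2, h2.1, h2.2]
  have h1 : Tendsto (fun n : ℕ => (h (x, g ^ n • x) - (B x - B (g ^ n • x))) / n) atTop (𝓝 0) := by
    refine squeeze_zero_norm (fun n => ?_)
      (tendsto_const_div_atTop_nhds_zero_nat (2 * δ + 1 + C))
    rw [norm_div, Real.norm_eq_abs, Real.norm_natCast]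
    gcongr
    exact key _ _
  have h2 : Tendsto (fun n : ℕ => (h (x, g ^ n • x) - (B x - B (g ^ n • x))) / n + -κ g) atTop
      (𝓝 (-κ g)) := by
    simpa using h1.add_const (-κ g)
  refine h2.congr' ?_
  filter_upwards [eventually_gt_atTop 0] with n hn
  have hn' : (n : ℝ) ≠ 0 := by exact_mod_cast hn.ne'
  rw [H.smul, equivariant_pow H.smul]
  field_simp
  ring

theorem actsProperlyOff [IsIsometricSMul M X] [TopologicalSpace M]
    (H : IsEquivariantHorofunction ξ B κ C) (hproper : IsMetricallyProper M X) (o : X)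
    {U : Subgroup M} (hU : IsClosed (U : Set M)) (hκ : ∀ u ∈ U, κ u = 0) :
    ActsProperlyOff U ξ := by
  intro K hK hξ
  obtain ⟨R, hR⟩ := H.exists_dist_le_of_isClosed o hK hξ
  refine ⟨fun x => ⟨2 * dist x o + R, fun u hu => ?_⟩, ?_⟩
  · have h1 := dist_triangle4 x o ((u : M) • o) ((u : M) • x)
    rw [dist_smul, dist_comm o x] at h1
    linarith [hR u (hκ u u.2) hu]
  · have hc := hU.isClosedEmbedding_subtypeVal.isCompact_preimage
      (hproper.isCompact_setOf_dist_le o R)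
    have hcl := ((isClosed_Iic (a := R)).preimage (hproper o).continuous).preimage
      (continuous_subtype_val (p := (· ∈ U)))
    refine hc.of_isClosed_subset isClosed_closure (closure_minimal ?_ hcl)
    exact fun u hu => hR u (hκ u u.2) hu

end IsEquivariantHorofunction

end Hyp

theorem proposition5 {X : Type*} [MetricSpace X] [Hyp.IsGromovHyperbolic X]
    (hgeod : Hyp.IsGeodesic X) (hX : Hyp.IsNonElementary X)
    {M : Type*} [Group M] [TopologicalSpace M] [IsTopologicalGroup M]
    [LocallyCompactSpace M] [T2Space M] (hM : Hyp.IsAmenable M)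
    [MulAction M X] [IsIsometricSMul M X] [ContinuousSMul M X]
    (hproper : Hyp.IsMetricallyProper M X) (hcob : Hyp.IsCobounded M X) :
    Hyp.IsFocal M X ∧
    ∃ ξ : Hyp.Boundary X, (∀ ζ : Hyp.Boundary X, (∀ g : M, g • ζ = ζ) ↔ ζ = ξ) ∧
    ∃ β : M →* Multiplicative ℝ,
      Hyp.IsBusemannQuasicharacter ξ (fun g : M => (β g).toAdd) ∧
      Continuous (fun g : M => (β g).toAdd) ∧
      IsClosed (Set.range fun g : M => (β g).toAdd) ∧
      (∃ g : M, (β g).toAdd ≠ 0) ∧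
      (∀ α : M, α ∉ β.ker →
        IsClosed (Subgroup.closure ((β.ker : Set M) ∪ {α}) : Set M) ∧
        CompactSpace (M ⧸ Subgroup.closure ((β.ker : Set M) ∪ {α})) ∧
        (Subgroup.closure ((β.ker : Set M) ∪ {α})).Normal ∧
        (∃ e : β.ker ⋊[Hyp.conjCyclic β.ker α] Subgroup.zpowers α ≃*
            Subgroup.closure ((β.ker : Set M) ∪ {α}),
          ∀ p, (e p : M) = (p.left : M) * (p.right : M)) ∧
        Topology.IsEmbedding
          (fun p : β.ker × Subgroup.zpowers α => (p.1 : M) * (p.2 : M))) ∧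
      Hyp.ActsProperlyOff β.ker ξ ∧
      (∀ η ζ : Hyp.Boundary X, η ≠ ξ → ζ ≠ ξ → ∃ u ∈ β.ker, u • η = ζ) ∧
      (∀ α : M, (β α).toAdd < 0 → Hyp.IsCompacting (MulAut.conjNormal α : MulAut β.ker)) := by
  obtain ⟨o, -, -⟩ := id hcob
  have : Nonempty X := ⟨o⟩
  obtain ⟨ξ, hξ⟩ := hM.exists_fixed hgeod hX hcob
  obtain ⟨B, κ, C, hC, H⟩ := hM.exists_equivariantHorofunction hξ o
  refine ⟨H.isFocal hC hgeod hX hξ hproper hcob o, ξ,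
    H.fixed_iff hC hgeod hX hξ hproper hcob o, ?_⟩
  let β : M →* Multiplicative ℝ :=
    { toFun := fun g => Multiplicative.ofAdd (-κ g)
      map_one' := by rw [Hyp.equivariant_one H.smul, neg_zero, ofAdd_zero]
      map_mul' := fun g k => by rw [Hyp.equivariant_mul H.smul, neg_add, ofAdd_add] }
  have hβ : ∀ g, (β g).toAdd = -κ g := fun g => rfl
  have hker : ∀ g, g ∈ β.ker ↔ κ g = 0 := fun g => by
    rw [MonoidHom.mem_ker, ← Multiplicative.toAdd.injective.eq_iff, hβ, toAdd_one, neg_eq_zero]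
  have hcont : Continuous fun g : M => (β g).toAdd := (H.continuous o).neg
  have hU : IsClosed (β.ker : Set M) := by
    convert isClosed_singleton.preimage (H.continuous o) (t := {0}) using 1
    ext g
    exact hker g
  obtain ⟨α₀, hα₀⟩ := H.exists_apply_neg hgeod hcob o
  refine ⟨β, H.isBusemannQuasicharacter, hcont, ?_, ⟨α₀, ?_⟩, fun α hα => ?_, ?_, ?_, ?_⟩
  · convert H.isClosed_range hC hgeod hproper hcob o using 1
    refine Set.Subset.antisymm ?_ ?_ <;> rintro _ ⟨g, rfl⟩ <;> refine ⟨g⁻¹, ?_⟩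
    · exact Hyp.equivariant_inv H.smul g
    · show (β g⁻¹).toAdd = κ g
      rw [hβ, Hyp.equivariant_inv H.smul, neg_neg]
  · rw [hβ]
    exact (neg_pos.2 hα₀).ne'
  · obtain ⟨E, hE⟩ := H.exists_apply_eq_dist_le hC hgeod hcob o
    refine ⟨Hyp.isClosed_closure_ker_union β hcont hα,
      Hyp.compactSpace_quotient_closure_ker_union β hα
        (hproper.isCompact_setOf_dist_le o (|(β α).toAdd| + E)) fun g hg => ?_,
      Hyp.normal_closure_ker_union β, Hyp.exists_semidirect_mulEquiv β hα,
      Hyp.isEmbedding_ker_mul_zpowers β hcont hα⟩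
    obtain ⟨k, hk, hk'⟩ := hE g
    rw [hβ g, abs_neg] at hg
    exact ⟨k, hk'.trans (by linarith), Multiplicative.toAdd.injective (by rw [hβ, hβ, hk])⟩
  · exact H.actsProperlyOff hproper o hU fun u hu => (hker u).1 hu
  · intro η ζ hη hζ
    obtain ⟨u, hu, hu'⟩ := H.ker_transitive hC hgeod hproper hcob o hη hζ
    exact ⟨u, (hker u).2 hu, hu'⟩
  · intro α hα
    rw [hβ] at hα
    obtain ⟨R, hR⟩ := H.exists_conj_dist_le hC o (α := α) (by linarith)
    exact Hyp.isCompacting_conjNormal hU (hproper.isCompact_setOf_dist_le o R)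
      fun u hu => hR u ((hker u).1 hu)
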